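/- Let $(M,g)$ be a smooth Riemannian manifold, $U\subset M$ open, and $r$ a smooth distance function on $U$, i.e. $r:U\to\mathbb R$ is smooth and its gradient $X=\operatorname{grad}_g r$ satisfies $|X|_g\equiv 1$. Let $\mathcal O$ be a smooth distribution on $U$ and let $S\subset U$ be a set with $\mathcal O_p\perp X_p$ for all $p\in S$ (for instance the union of a family of totally geodesic flat submanifolds to which $X$ is tangent and $\mathcal O$ is normal; or $S=U$ if $\mathcal O\perp X$ everywhere). For a smooth function $f:\mathbb R\to\mathbb R$ put $\varphi=f\circ r$, $\varphi'=f'\circ r$, $\varphi''=f''\circ r$. If $f>0$, let $\tilde g=\varphi^2 g_{\mathcal O}+g_{\mathcal O^\perp}$ be the metric on $U$ obtained from $g=g_{\mathcal O}+g_{\mathcal O^{\perp}}$ by multiplying the lengths of all vectors in $\mathcal O$ by $\varphi$ while keeping the $g$-orthogonal complement $\mathcal O^\perp$ and the metric on it fixed. Let $R^g,R^{\tilde g}$ be the $(0,4)$ curvature tensors, $R(A,B,C,D)=\langle R(A,B)C,D\rangle$ with $R(A,B)=[\nabla_A,\nabla_B]-\nabla_{[A,B]}$. Then: 1. For every smooth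 $f$, $D_XD_X\varphi=\varphi''$ on $U$. 2. For $V\in\mathcal O$ over $S$, $$R^{\tilde g}(V,X,X,V)=R^{g}(V,X,X,V)-\varphi''\,|V|_g^2\,|X|_g^2+O(C^1),$$ in the following sense. For every compact $K\subset U$ there is a constant $C$, depending only on $g,r,\mathcal O,K$ and not on $f$, such that for every smooth $f>0$, every $p\in K\cap S$ with $\max\{|1-\varphi(p)|,|\varphi'(p)|\}\le\tfrac12$, and every $V\in\mathcal O_p$, $$\Bigl|R^{\tilde g}(V,X,X,V)-R^{g}(V,X,X,V)+\varphi''(p)|V|_g^2|X|_g^2\Bigr|\le \bigl(C+|\varphi''(p)|\bigr)\max\{|1-\varphi(p)|,|\varphi'(p)|\}\,|V|_g^2\,|X|_g^2 .$$ In particular, as long as $|\varphi''|$ stays bounded, the error is bounded by a constant times the $C^1$-distance of $\varphi$ from $1$. -/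

import Mathlib

open scoped Manifold ContDiff

noncomputable section

namespace PartialConformal

section VectorSpace

variable {E : Type*} [NormedAddCommGroup E] [NormedSpace ℝ E]

/-- The Christoffel symbol `Γ(u, v) = ∇_u v` of the metric `G` on the vector space `E`, for
constant vector fields `u`, `v`. It is the vector determined by
`2 G_y(Γ(u, v), w) = D_u G(v, w) + D_v G(u, w) - D_w G(u, v)` for all `w`; the inverse is that of
the isomorphism `z ↦ G_y(z, ·)` from `E` to its dual. -/
def christoffel (G : E → E →L[ℝ] E →L[ℝ] ℝ) (y u v : E) : E :=
  (1 / 2 : ℝ) • (G y).inverse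
    (fderiv ℝ G y u v + fderiv ℝ G y v u - ((fderiv ℝ G y).flip u).flip v)

/-- The curvature `R(u, v)w = ∇_u ∇_v w - ∇_v ∇_u w` of the metric `G` on the vector space `E`
at the point `y`, for constant vector fields `u`, `v`, `w` (so that `[u, v] = 0`). -/
def coordCurvature (G : E → E →L[ℝ] E →L[ℝ] ℝ) (y u v w : E) : E :=
  fderiv ℝ (fun y' ↦ christoffel G y' v w) y u - fderiv ℝ (fun y' ↦ christoffel G y' u w) y v
    + christoffel G y u (christoffel G y v w) - christoffel G y v (christoffel G y u w)

end VectorSpace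

section Manifold

variable {E : Type*} [NormedAddCommGroup E] [NormedSpace ℝ E]
  {M : Type*} [TopologicalSpace M] [ChartedSpace E M]

/-- The expression of a field of bilinear forms on `M` in the coordinates of a chart `e`, that is,
its pullback under `e.symm`. -/
def metricInChart
    (B : ∀ q : M, TangentSpace 𝓘(ℝ, E) q →L[ℝ] TangentSpace 𝓘(ℝ, E) q →L[ℝ] ℝ)
    (e : OpenPartialHomeomorph M E) (y : E) : E →L[ℝ] E →L[ℝ] ℝ :=
  let A : E →L[ℝ] E := mfderiv 𝓘(ℝ, E) 𝓘(ℝ, E) e.symm y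
  let B' : E →L[ℝ] E →L[ℝ] ℝ := B (e.symm y)
  B'.bilinearComp A A

/-- The curvature tensor `R(a, b, c, d) = B(R(a, b)c, d)` at the point `p` of a (semi-)Riemannian
metric `B` on a neighbourhood of `p`, computed in the coordinates of the preferred chart at `p`.
With this convention `R(v, x, x, v)` is the sectional curvature of the plane spanned by
orthonormal vectors `v`, `x`. -/
def curvatureTensor
    (B : ∀ q : M, TangentSpace 𝓘(ℝ, E) q →L[ℝ] TangentSpace 𝓘(ℝ, E) q →L[ℝ] ℝ)
    (p : M) (a b c d : TangentSpace 𝓘(ℝ, E) p) : ℝ :=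
  let e : OpenPartialHomeomorph M E := chartAt E p
  let T : TangentSpace 𝓘(ℝ, E) p → E := fun v ↦ mfderiv 𝓘(ℝ, E) 𝓘(ℝ, E) e p v
  let G : E → E →L[ℝ] E →L[ℝ] ℝ := metricInChart B e
  G (e p) (coordCurvature G (e p) (T a) (T b) (T c)) (T d)

/-- The derivative `D_X h` of a function `h` along a vector field `X`. -/
def dirDeriv (X : ∀ q : M, TangentSpace 𝓘(ℝ, E) q) (h : M → ℝ) (p : M) : ℝ :=
  mfderiv 𝓘(ℝ, E) 𝓘(ℝ, ℝ) h p (X p)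

/-- The set `O` of subspaces of the tangent spaces is a smooth distribution on `U`: near each
point of `U` it is spanned by a smooth frame. -/
def IsSmoothDistributionOn [IsManifold 𝓘(ℝ, E) ∞ M]
    (O : ∀ q : M, Submodule ℝ (TangentSpace 𝓘(ℝ, E) q)) (U : Set M) : Prop :=
  ∀ p ∈ U, ∃ N : Set M, IsOpen N ∧ p ∈ N ∧ ∃ (k : ℕ) (F : Fin k → ∀ q : M, TangentSpace 𝓘(ℝ, E) q),
    (∀ i, ContMDiffOn 𝓘(ℝ, E) 𝓘(ℝ, E).tangent ∞
      (fun q ↦ (⟨q, F i q⟩ : TangentBundle 𝓘(ℝ, E) M)) N) ∧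
    ∀ q ∈ N, LinearIndependent ℝ (fun i ↦ F i q) ∧
      Submodule.span ℝ (Set.range fun i ↦ F i q) = O q

variable [FiniteDimensional ℝ E] [IsManifold 𝓘(ℝ, E) ∞ M]

/-- A smooth Riemannian metric on `M`. -/
abbrev RiemMetric (E M : Type*) [NormedAddCommGroup E] [NormedSpace ℝ E]
    [TopologicalSpace M] [ChartedSpace E M] [IsManifold 𝓘(ℝ, E) ∞ M] :=
  Bundle.ContMDiffRiemannianMetric 𝓘(ℝ, E) ∞ E (fun q : M ↦ TangentSpace 𝓘(ℝ, E) q)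

/-- The gradient of `r`: the vector field determined by `g(grad r, v) = dr(v)` for all `v`. -/
def gradient (g : RiemMetric E M) (r : M → ℝ) (p : M) : TangentSpace 𝓘(ℝ, E) p :=
  (g.inner p).inverse (mfderiv 𝓘(ℝ, E) 𝓘(ℝ, ℝ) r p)

/-- `r` is a smooth distance function on `U`: it is smooth there and its gradient has length
one. -/
def IsDistanceFunctionOn (g : RiemMetric E M) (r : M → ℝ) (U : Set M) : Prop :=
  ContMDiffOn 𝓘(ℝ, E) 𝓘(ℝ, ℝ) ∞ r U ∧
    ∀ p ∈ U, g.inner p (gradient g r p) (gradient g r p) = 1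

/-- The inner product `g_p` as a bilinear form. -/
def innerForm (g : RiemMetric E M) (p : M) : LinearMap.BilinForm ℝ (TangentSpace 𝓘(ℝ, E) p) :=
  (g.inner p).toBilinForm

theorem isCompl_orthogonal (g : RiemMetric E M) (p : M)
    (S : Submodule ℝ (TangentSpace 𝓘(ℝ, E) p)) :
    IsCompl S ((innerForm g p).orthogonal S) := by
  have : FiniteDimensional ℝ (TangentSpace 𝓘(ℝ, E) p) := inferInstanceAs (FiniteDimensional ℝ E)
  have hr : (innerForm g p).IsRefl := fun v w h ↦ by
    rw [← h]; exact g.symm p w v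
  rw [LinearMap.BilinForm.isCompl_orthogonal_iff_disjoint hr, Submodule.disjoint_def]
  intro v hv hv'
  by_contra h0
  exact (g.pos p v h0).ne' (hv' v hv)

/-- The `g`-orthogonal projection of `T_p M` onto `S`. -/
def orthProj (g : RiemMetric E M) (p : M) (S : Submodule ℝ (TangentSpace 𝓘(ℝ, E) p)) :
    TangentSpace 𝓘(ℝ, E) p →L[ℝ] TangentSpace 𝓘(ℝ, E) p :=
  haveI : FiniteDimensional ℝ (TangentSpace 𝓘(ℝ, E) p) := inferInstanceAs (FiniteDimensional ℝ E)
  haveI : T2Space (TangentSpace 𝓘(ℝ, E) p) := inferInstanceAs (T2Space E)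
  LinearMap.toContinuousLinearMap (Submodule.projection S _ (isCompl_orthogonal g p S))

/-- The partial conformal change of `g` along `O` with factor `φ`: the orthogonal splitting
`g = g_O + g_{O^⊥}` is replaced by `φ² g_O + g_{O^⊥}`, so that lengths of vectors in `O` are
multiplied by `φ`, and `O^⊥` and the metric on it are kept. -/
def partialConformalChange (g : RiemMetric E M)
    (O : ∀ q : M, Submodule ℝ (TangentSpace 𝓘(ℝ, E) q)) (φ : M → ℝ) (p : M) :
    TangentSpace 𝓘(ℝ, E) p →L[ℝ] TangentSpace 𝓘(ℝ, E) p →L[ℝ] ℝ :=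
  let P : E →L[ℝ] E := orthProj g p (O p)
  let Q : E →L[ℝ] E := ContinuousLinearMap.id ℝ E - P
  let B : E →L[ℝ] E →L[ℝ] ℝ := g.inner p
  (φ p ^ 2 • B.bilinearComp P P + B.bilinearComp Q Q : E →L[ℝ] E →L[ℝ] ℝ)

end Manifold

end PartialConformal

end

/-! Since `g = g_O + g_{O^⊥}`, the new metric is `g + (φ² - 1) g_O`. In a chart it has the form `G +
(F ∘ ρ) H`, where `G`, `H`, `ρ` express `g`, `g_O`, `r` and `F = f² - 1`. The function `f` enters
only through `F`.

The lowered curvature is a universal expression in the 2-jet of the metric: linear in second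
derivatives, quadratic in first derivatives, with one inverse of the metric
(`apply_coordCurvature`). The second derivative of `F` occurs only in the term `F''(ρ) dρ ⊗ dρ ⊗ H`.
For `V` in `O` over `S` one has `dρ(V) = g(X, V) = 0`, `dρ(X) = 1` and `H(V, V) = |V|²`, so this
term contributes exactly `-½ F'' |V|²` to `R(V, X, X, V)`, and `½ F'' = f f'' + f'²` is `f''` up to
the error `f'² - (1 - f) f''` (`apply_coordCurvature_add_comp_smul`).

Everything else is a function `jetCurvature` of the point, the two numbers `s = F(ρ)` and `t =
F'(ρ)`, and the vectors; at `s = t = 0` it is the curvature of `g`. It is `C¹` wherever `G + s H` is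
invertible, hence Lipschitz on compact convex sets with a constant that knows nothing of `f`, while
`|s|` and `|t|` are at most three times the `C¹`-distance of `φ` from `1`
(`exists_jetCurvature_lipschitz`, `exists_coordCurvature_bound`).

Two facts make this usable on `M`. The curvature tensor is defined by a different chart at each
point, so naturality under transition maps (`curvatureTensor_eq_chart`) is needed to treat a
neighbourhood in a single chart. The form `g_O` is smooth because it is given by inverse Gram
matrices of local frames (`contDiffAt_metricInChart_projForm`). Compactness then turns local
constants into one for `K`. The first claim is the chain rule together with `dr(X) = g(X, X) = 1`.
-/

noncomputable section

namespace PartialConformal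

/-! ### Christoffel symbols and lowered curvature in a vector space -/

section Coordinates

set_option maxSynthPendingDepth 3

variable {E : Type*} [NormedAddCommGroup E] [NormedSpace ℝ E]

/-- The linear operator taking the first derivative of a metric to its Christoffel symbols of the
first kind. -/
def koszulOp : (E →L[ℝ] E →L[ℝ] E →L[ℝ] ℝ) →L[ℝ] E →L[ℝ] E →L[ℝ] E →L[ℝ] ℝ :=
  let T : (E →L[ℝ] E →L[ℝ] E →L[ℝ] ℝ) →L[ℝ] E →L[ℝ] E →L[ℝ] E →L[ℝ] ℝ :=
    (ContinuousLinearMap.flipₗᵢ ℝ E E (E →L[ℝ] ℝ)).toContinuousLinearEquiv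
  let T' : (E →L[ℝ] E →L[ℝ] ℝ) →L[ℝ] E →L[ℝ] E →L[ℝ] ℝ :=
    (ContinuousLinearMap.flipₗᵢ ℝ E E ℝ).toContinuousLinearEquiv
  (1 / 2 : ℝ) • (ContinuousLinearMap.id ℝ _ + T
    - (ContinuousLinearMap.compL ℝ E (E →L[ℝ] E →L[ℝ] ℝ) (E →L[ℝ] E →L[ℝ] ℝ) T').comp T)

theorem koszulOp_apply (L : E →L[ℝ] E →L[ℝ] E →L[ℝ] ℝ) (u v w : E) :
    koszulOp L u v w = (1 / 2 : ℝ) * (L u v w + L v u w - L w u v) := by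
  simp [koszulOp]

/-- The Christoffel symbols of the first kind: `koszul G y u v w = G_y(∇_u v, w)`. -/
def koszul (G : E → E →L[ℝ] E →L[ℝ] ℝ) (y : E) : E →L[ℝ] E →L[ℝ] E →L[ℝ] ℝ :=
  koszulOp (fderiv ℝ G y)

theorem koszul_apply (G : E → E →L[ℝ] E →L[ℝ] ℝ) (y u v w : E) :
    koszul G y u v w
      = (1 / 2 : ℝ) * (fderiv ℝ G y u v w + fderiv ℝ G y v u w - fderiv ℝ G y w u v) := by
  simp [koszul, koszulOp_apply]

/-- The Christoffel symbols as a continuous bilinear map. -/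
def christoffelCLM (G : E → E →L[ℝ] E →L[ℝ] ℝ) (y : E) : E →L[ℝ] E →L[ℝ] E :=
  (ContinuousLinearMap.compL ℝ E (E →L[ℝ] ℝ) E (G y).inverse).comp (koszul G y)

theorem christoffel_eq_inverse_koszul (G : E → E →L[ℝ] E →L[ℝ] ℝ) (y u v : E) :
    christoffel G y u v = (G y).inverse (koszul G y u v) := by
  rw [christoffel, ← map_smul]
  congr 1

theorem christoffelCLM_apply (G : E → E →L[ℝ] E →L[ℝ] ℝ) (y u v : E) :
    christoffelCLM G y u v = christoffel G y u v := by
  rw [christoffel_eq_inverse_koszul]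
  rfl

theorem apply_christoffel {G : E → E →L[ℝ] E →L[ℝ] ℝ} {y : E} (hi : (G y).IsInvertible)
    (u v : E) : G y (christoffel G y u v) = koszul G y u v := by
  rw [christoffel_eq_inverse_koszul, hi.self_apply_inverse]

theorem fderiv_bilin_apply {F : Type*} [NormedAddCommGroup F] [NormedSpace ℝ F]
    {G : F → E →L[ℝ] E →L[ℝ] ℝ} {y : F} (hG : DifferentiableAt ℝ G y)
    (u : F) (v w : E) : fderiv ℝ (fun y' ↦ G y' v w) y u = fderiv ℝ G y u v w := by
  have h := (hG.hasFDerivAt.clm_apply (hasFDerivAt_const v y)).clm_apply (hasFDerivAt_const w y)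
  rw [h.fderiv]
  simp

theorem fderiv_symm_of_eventually {G : E → E →L[ℝ] E →L[ℝ] ℝ} {y : E}
    (hG : DifferentiableAt ℝ G y) (hs : ∀ᶠ y' in nhds y, ∀ v w, G y' v w = G y' w v)
    (u v w : E) : fderiv ℝ G y u v w = fderiv ℝ G y u w v := by
  rw [← fderiv_bilin_apply hG, ← fderiv_bilin_apply hG]
  congr 1
  exact Filter.EventuallyEq.fderiv_eq (hs.mono fun y' h ↦ h v w)

theorem differentiableAt_koszul {G : E → E →L[ℝ] E →L[ℝ] ℝ} {y : E} (hG : ContDiffAt ℝ 2 G y) :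
    DifferentiableAt ℝ (koszul G) y := by
  have h1 : DifferentiableAt ℝ (fderiv ℝ G) y :=
    (hG.fderiv_right (m := 1) (by norm_num)).differentiableAt (by norm_num)
  exact (koszulOp (E := E)).differentiableAt.comp y h1

theorem fderiv_koszul_apply {G : E → E →L[ℝ] E →L[ℝ] ℝ} {y : E} (hG : ContDiffAt ℝ 2 G y)
    (u v w d : E) :
    fderiv ℝ (fun y' ↦ koszul G y' v w d) y u
      = koszulOp (fderiv ℝ (fderiv ℝ G) y u) v w d := by
  have h1 : DifferentiableAt ℝ (fderiv ℝ G) y :=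
    (hG.fderiv_right (m := 1) (by norm_num)).differentiableAt (by norm_num)
  have h2 := (((koszulOp (E := E)).hasFDerivAt.comp y h1.hasFDerivAt).clm_apply
    (hasFDerivAt_const v y)).clm_apply (hasFDerivAt_const w y) |>.clm_apply (hasFDerivAt_const d y)
  have h3 := h2.fderiv
  simp only [Function.comp_def] at h3
  simp only [koszul]
  rw [h3]
  simp

theorem differentiableAt_christoffelCLM [CompleteSpace E] {G : E → E →L[ℝ] E →L[ℝ] ℝ} {y : E}
    (hG : ContDiffAt ℝ 2 G y) (hi : (G y).IsInvertible) :
    DifferentiableAt ℝ (christoffelCLM G) y := by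
  have h1 : DifferentiableAt ℝ (fun y ↦ (G y).inverse) y :=
    ((hi.contDiffAt_map_inverse (n := 1)).comp y (hG.of_le (by norm_num))).differentiableAt
      (by norm_num)
  exact (((ContinuousLinearMap.compL ℝ E (E →L[ℝ] ℝ) E).differentiableAt).comp y h1).clm_comp
    (differentiableAt_koszul hG)

theorem eventually_isInvertible [CompleteSpace E] {X F : Type*} [TopologicalSpace X]
    [NormedAddCommGroup F] [NormedSpace ℝ F] {G : X → E →L[ℝ] F} {y : X}
    (hG : ContinuousAt G y) (hi : (G y).IsInvertible) :
    ∀ᶠ y' in nhds y, (G y').IsInvertible :=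
  hG.eventually (ContinuousLinearEquiv.isOpen.mem_nhds hi)

/-- The lowered curvature as an expression in the `2`-jet of the metric. -/
theorem apply_coordCurvature [CompleteSpace E] {G : E → E →L[ℝ] E →L[ℝ] ℝ} {y : E}
    (hG : ContDiffAt ℝ 2 G y) (hi : (G y).IsInvertible)
    (hs : ∀ᶠ y' in nhds y, ∀ v w, G y' v w = G y' w v) (u v w d : E) :
    G y (coordCurvature G y u v w) d
      = fderiv ℝ (fun y' ↦ koszul G y' v w d) y u - fderiv ℝ (fun y' ↦ koszul G y' u w d) y v
        - koszul G y u d ((G y).inverse (koszul G y v w))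
        + koszul G y v d ((G y).inverse (koszul G y u w)) := by
  have hd : DifferentiableAt ℝ G y := hG.differentiableAt (by norm_num)
  have hΓ : ∀ a b, DifferentiableAt ℝ (fun y' ↦ christoffel G y' a b) y := fun a b ↦ by
    simp_rw [← christoffelCLM_apply]
    exact ((differentiableAt_christoffelCLM hG hi).clm_apply (differentiableAt_const _)).clm_apply
      (differentiableAt_const _)
  -- Differentiating `G(Γ(a, b), d) = koszul a b d` by the product rule avoids derivatives of the
  -- inverse metric.
  have key : ∀ a b c, G y (fderiv ℝ (fun y' ↦ christoffel G y' a b) y c) d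
      = fderiv ℝ (fun y' ↦ koszul G y' a b d) y c - fderiv ℝ G y c (christoffel G y a b) d := by
    intro a b c
    have h1 := (hd.hasFDerivAt.clm_apply (hΓ a b).hasFDerivAt).clm_apply (hasFDerivAt_const d y)
    have h2 : (fun y' ↦ koszul G y' a b d) =ᶠ[nhds y] fun y' ↦ G y' (christoffel G y' a b) d :=
      (eventually_isInvertible hG.continuousAt hi).mono fun y' h ↦ by
        simp only [apply_christoffel h]
    rw [h2.fderiv_eq, h1.fderiv]
    simp
  -- Metric compatibility: `D_a G(z, d) = G(∇_a z, d) + G(z, ∇_a d)`.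
  have k2 : ∀ a z, koszul G y a z d - fderiv ℝ G y a z d = - koszul G y a d z := by
    intro a z
    rw [koszul_apply, koszul_apply, fderiv_symm_of_eventually hd hs a d z,
      fderiv_symm_of_eventually hd hs d a z]
    have := fderiv_symm_of_eventually hd hs z a d
    linarith
  have e1 := k2 u (christoffel G y v w)
  have e2 := k2 v (christoffel G y u w)
  simp only [coordCurvature, map_add, map_sub, add_apply,
    sub_apply, key, apply_christoffel hi,
    ← christoffel_eq_inverse_koszul]
  linarith

end Coordinates

/-! ### Behaviour of Christoffel symbols and curvature under coordinate changes -/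

section CoordinateChange

set_option maxSynthPendingDepth 3

variable {E : Type*} [NormedAddCommGroup E] [NormedSpace ℝ E]

theorem isInvertible_of_posDef [FiniteDimensional ℝ E] {B : E →L[ℝ] E →L[ℝ] ℝ}
    (hB : ∀ v, v ≠ 0 → 0 < B v v) : B.IsInvertible := by
  have hinj : Function.Injective B.toLinearMap := by
    rw [injective_iff_map_eq_zero]
    intro v hv
    by_contra h0
    have h1 := hB v h0
    have h2 : B v = 0 := hv
    rw [h2] at h1
    simp at h1
  have hd : Module.finrank ℝ E = Module.finrank ℝ (E →L[ℝ] ℝ) := by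
    rw [← (LinearMap.toContinuousLinearMap (𝕜 := ℝ) (E := E) (F' := ℝ)).finrank_eq]
    exact (Subspace.dual_finrank_eq (K := ℝ) (V := E)).symm
  exact ⟨(LinearEquiv.ofInjectiveOfFinrankEq _ hinj hd).toContinuousLinearEquiv, by ext; rfl⟩

theorem fderiv_pullback {G G' : E → E →L[ℝ] E →L[ℝ] ℝ} {Φ : E → E} {y : E}
    (hΦ : ContDiffAt ℝ 2 Φ y) (hG' : DifferentiableAt ℝ G' (Φ y))
    (hG : ∀ᶠ y' in nhds y, ∀ v w, G y' v w = G' (Φ y') (fderiv ℝ Φ y' v) (fderiv ℝ Φ y' w))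
    (hGd : DifferentiableAt ℝ G y) (u v w : E) :
    fderiv ℝ G y u v w
      = fderiv ℝ G' (Φ y) (fderiv ℝ Φ y u) (fderiv ℝ Φ y v) (fderiv ℝ Φ y w)
        + G' (Φ y) (fderiv ℝ (fderiv ℝ Φ) y u v) (fderiv ℝ Φ y w)
        + G' (Φ y) (fderiv ℝ Φ y v) (fderiv ℝ (fderiv ℝ Φ) y u w) := by
  have hA : HasFDerivAt (fderiv ℝ Φ) (fderiv ℝ (fderiv ℝ Φ) y) y :=
    ((hΦ.fderiv_right (m := 1) (by norm_num)).differentiableAt (by norm_num)).hasFDerivAt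
  have hc : HasFDerivAt (fun y' ↦ G' (Φ y')) ((fderiv ℝ G' (Φ y)).comp (fderiv ℝ Φ y)) y :=
    hG'.hasFDerivAt.comp y (hΦ.differentiableAt (by norm_num)).hasFDerivAt
  have h := (hc.clm_apply (hA.clm_apply (hasFDerivAt_const v y))).clm_apply
    (hA.clm_apply (hasFDerivAt_const w y))
  have he : (fun y' ↦ G y' v w) =ᶠ[nhds y]
      fun y' ↦ G' (Φ y') (fderiv ℝ Φ y' v) (fderiv ℝ Φ y' w) := hG.mono fun y' h ↦ h v w
  rw [← fderiv_bilin_apply hGd, he.fderiv_eq, h.fderiv]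
  simp
  ring

/-- Differentiating the pullback produces six terms with second derivatives of `Φ`. By symmetry of
`D²Φ` and of `G'`, the signs of the Koszul combination cancel four of them and double `G'(D²Φ(u, v),
DΦ w)`. -/
theorem koszul_pullback {G G' : E → E →L[ℝ] E →L[ℝ] ℝ} {Φ : E → E} {y : E}
    (hΦ : ContDiffAt ℝ 2 Φ y) (hG' : DifferentiableAt ℝ G' (Φ y))
    (hs : ∀ v w, G' (Φ y) v w = G' (Φ y) w v)
    (hG : ∀ᶠ y' in nhds y, ∀ v w, G y' v w = G' (Φ y') (fderiv ℝ Φ y' v) (fderiv ℝ Φ y' w))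
    (hGd : DifferentiableAt ℝ G y) (u v w : E) :
    koszul G y u v w
      = koszul G' (Φ y) (fderiv ℝ Φ y u) (fderiv ℝ Φ y v) (fderiv ℝ Φ y w)
        + G' (Φ y) (fderiv ℝ (fderiv ℝ Φ) y u v) (fderiv ℝ Φ y w) := by
  have hsym : IsSymmSndFDerivAt ℝ Φ y := hΦ.isSymmSndFDerivAt (by simp)
  simp only [koszul_apply, fderiv_pullback hΦ hG' hG hGd]
  rw [hsym.eq v u, hsym.eq w u, hsym.eq w v, hs (fderiv ℝ (fderiv ℝ Φ) y u w) (fderiv ℝ Φ y v)]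
  ring

/-- The transformation law of the Christoffel symbols under a change of coordinates. -/
theorem fderiv_christoffel_pullback {G G' : E → E →L[ℝ] E →L[ℝ] ℝ} {Φ : E → E} {y : E}
    (hΦ : ContDiffAt ℝ 2 Φ y) (hA : (fderiv ℝ Φ y).IsInvertible)
    (hG' : DifferentiableAt ℝ G' (Φ y)) (hi' : (G' (Φ y)).IsInvertible)
    (hs : ∀ v w, G' (Φ y) v w = G' (Φ y) w v)
    (hG : ∀ᶠ y' in nhds y, ∀ v w, G y' v w = G' (Φ y') (fderiv ℝ Φ y' v) (fderiv ℝ Φ y' w))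
    (hGd : DifferentiableAt ℝ G y) (hi : (G y).IsInvertible) (u v : E) :
    fderiv ℝ Φ y (christoffel G y u v)
      = christoffel G' (Φ y) (fderiv ℝ Φ y u) (fderiv ℝ Φ y v)
        + fderiv ℝ (fderiv ℝ Φ) y u v := by
  -- It suffices to compare the pairings under `G'` with vectors `DΦ w`, which exhaust `E`; that is
  -- `koszul_pullback`.
  apply hi'.bijective.injective
  ext z
  obtain ⟨w, rfl⟩ := hA.bijective.surjective z
  rw [← hG.self_of_nhds, apply_christoffel hi, koszul_pullback hΦ hG' hs hG hGd, map_add,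
    apply_christoffel hi', add_apply]

/-- Curvature is natural under changes of coordinates. -/
theorem fderiv_coordCurvature_pullback [CompleteSpace E] {G G' : E → E →L[ℝ] E →L[ℝ] ℝ}
    {Φ : E → E} {y : E}
    (hΦ : ContDiffAt ℝ 3 Φ y) (hA : (fderiv ℝ Φ y).IsInvertible)
    (hG' : ContDiffAt ℝ 2 G' (Φ y)) (hi' : (G' (Φ y)).IsInvertible)
    (hs : ∀ᶠ z in nhds (Φ y), ∀ v w, G' z v w = G' z w v)
    (hG : ∀ᶠ y' in nhds y, ∀ v w, G y' v w = G' (Φ y') (fderiv ℝ Φ y' v) (fderiv ℝ Φ y' w))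
    (hGd : ContDiffAt ℝ 2 G y) (hi : (G y).IsInvertible) (u v w : E) :
    fderiv ℝ Φ y (coordCurvature G y u v w)
      = coordCurvature G' (Φ y) (fderiv ℝ Φ y u) (fderiv ℝ Φ y v) (fderiv ℝ Φ y w) := by
  have hΦ2 : ContDiffAt ℝ 2 Φ y := hΦ.of_le (by norm_num)
  have hAc : ContDiffAt ℝ 2 (fderiv ℝ Φ) y := hΦ.fderiv_right (by norm_num)
  have hA2c : ContDiffAt ℝ 1 (fderiv ℝ (fderiv ℝ Φ)) y := hAc.fderiv_right (by norm_num)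
  have hsymA : IsSymmSndFDerivAt ℝ (fderiv ℝ Φ) y := hAc.isSymmSndFDerivAt (by simp)
  have hsym : IsSymmSndFDerivAt ℝ Φ y := hΦ2.isSymmSndFDerivAt (by simp)
  have hcont : Filter.Tendsto Φ (nhds y) (nhds (Φ y)) := hΦ.continuousAt
  -- The transformation law is needed on a neighbourhood, because it is about to be differentiated.
  have hev : ∀ a b, (fun y' ↦ fderiv ℝ Φ y' (christoffel G y' a b)) =ᶠ[nhds y]
      fun y' ↦ christoffelCLM G' (Φ y') (fderiv ℝ Φ y' a) (fderiv ℝ Φ y' b)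
        + fderiv ℝ (fderiv ℝ Φ) y' a b := by
    intro a b
    filter_upwards [hΦ2.eventually (by simp), eventually_isInvertible hAc.continuousAt hA,
      hcont.eventually (hG'.eventually (by simp)),
      hcont.eventually (eventually_isInvertible hG'.continuousAt hi'), hcont.eventually hs,
      hG.eventually_nhds, hGd.eventually (by simp),
      eventually_isInvertible hGd.continuousAt hi] with y' h1 h2 h3 h4 h5 h6 h7 h8
    rw [christoffelCLM_apply]
    exact fderiv_christoffel_pullback h1 h2 (h3.differentiableAt (by norm_num)) h4 h5 h6
      (h7.differentiableAt (by norm_num)) h8 a b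
  have hΓ : ∀ a b, HasFDerivAt (fun y' ↦ christoffel G y' a b)
      (fderiv ℝ (fun y' ↦ christoffel G y' a b) y) y := fun a b ↦ by
    simp_rw [← christoffelCLM_apply]
    exact (((differentiableAt_christoffelCLM hGd hi).clm_apply
      (differentiableAt_const _)).clm_apply (differentiableAt_const _)).hasFDerivAt
  have hA' : HasFDerivAt (fderiv ℝ Φ) (fderiv ℝ (fderiv ℝ Φ) y) y :=
    (hAc.differentiableAt (by norm_num)).hasFDerivAt
  have hA2' : HasFDerivAt (fderiv ℝ (fderiv ℝ Φ)) (fderiv ℝ (fderiv ℝ (fderiv ℝ Φ)) y) y :=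
    (hA2c.differentiableAt (by norm_num)).hasFDerivAt
  have hΓ' := differentiableAt_christoffelCLM hG' hi'
  have hΓ'c : HasFDerivAt (fun y' ↦ christoffelCLM G' (Φ y'))
      ((fderiv ℝ (christoffelCLM G') (Φ y)).comp (fderiv ℝ Φ y)) y :=
    hΓ'.hasFDerivAt.comp y (hΦ.differentiableAt (by norm_num)).hasFDerivAt
  have hΓ'ab : ∀ a b c, fderiv ℝ (fun z ↦ christoffel G' z a b) (Φ y) c
      = fderiv ℝ (christoffelCLM G') (Φ y) c a b := fun a b c ↦ by
    simp_rw [← christoffelCLM_apply]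
    rw [((hΓ'.hasFDerivAt.clm_apply (hasFDerivAt_const a (Φ y))).clm_apply
      (hasFDerivAt_const b (Φ y))).fderiv]
    simp
  have key : ∀ a b c, fderiv ℝ Φ y (fderiv ℝ (fun y' ↦ christoffel G y' a b) y c)
      = fderiv ℝ (christoffelCLM G') (Φ y) (fderiv ℝ Φ y c) (fderiv ℝ Φ y a) (fderiv ℝ Φ y b)
        + christoffel G' (Φ y) (fderiv ℝ (fderiv ℝ Φ) y c a) (fderiv ℝ Φ y b)
        + christoffel G' (Φ y) (fderiv ℝ Φ y a) (fderiv ℝ (fderiv ℝ Φ) y c b)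
        + fderiv ℝ (fderiv ℝ (fderiv ℝ Φ)) y c a b
        - fderiv ℝ (fderiv ℝ Φ) y c (christoffel G y a b) := by
    intro a b c
    have h1 := hA'.clm_apply (hΓ a b)
    have h2 := ((hΓ'c.clm_apply (hA'.clm_apply (hasFDerivAt_const a y))).clm_apply
      (hA'.clm_apply (hasFDerivAt_const b y))).fun_add
      ((hA2'.clm_apply (hasFDerivAt_const a y)).clm_apply (hasFDerivAt_const b y))
    have h3 := (hev a b).fderiv_eq (𝕜 := ℝ)
    rw [h1.fderiv] at h3
    rw [h2.fderiv] at h3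
    have h4 := congrArg (fun L : E →L[ℝ] E ↦ L c) h3
    simp [christoffelCLM_apply] at h4
    rw [eq_sub_iff_add_eq, h4]
    abel
  have hlaw : ∀ a b, fderiv ℝ Φ y (christoffelCLM G y a b)
      = christoffelCLM G' (Φ y) (fderiv ℝ Φ y a) (fderiv ℝ Φ y b)
        + fderiv ℝ (fderiv ℝ Φ) y a b := fun a b ↦ by
    rw [christoffelCLM_apply, christoffelCLM_apply]
    exact fderiv_christoffel_pullback hΦ2 hA (hG'.differentiableAt (by norm_num))
      hi' hs.self_of_nhds hG (hGd.differentiableAt (by norm_num)) hi a b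
  simp only [coordCurvature, map_add, map_sub, key, hΓ'ab]
  simp only [← christoffelCLM_apply, hlaw, map_add]
  -- The third derivative of `Φ` and the term `Γ'(D²Φ(u, v), DΦ w)` are symmetric in `u`, `v`, so
  -- antisymmetrization removes them; the remaining second derivative terms cancel in pairs.
  rw [hsymA.eq v u, hsym.eq v u]
  abel

end CoordinateChange

/-! ### Curvature of `G + (F ∘ ρ) H` and its dependence on `F''` -/

section Perturbation

set_option maxSynthPendingDepth 3

variable {E : Type*} [NormedAddCommGroup E] [NormedSpace ℝ E]

/-- The tensor `dρ ⊗ H`. -/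
def dTensor (ρ : E → ℝ) (H : E → E →L[ℝ] E →L[ℝ] ℝ) (y : E) : E →L[ℝ] E →L[ℝ] E →L[ℝ] ℝ :=
  (fderiv ℝ ρ y).smulRight (H y)

/-- The derivative of `G + (F ∘ ρ) H`, in terms of `s = F (ρ y)` and `t = F' (ρ y)`. -/
def firstJet (G H : E → E →L[ℝ] E →L[ℝ] ℝ) (ρ : E → ℝ) (y : E) (s t : ℝ) :
    E →L[ℝ] E →L[ℝ] E →L[ℝ] ℝ :=
  fderiv ℝ G y + t • dTensor ρ H y + s • fderiv ℝ H y

/-- The part of the second derivative of `G + (F ∘ ρ) H` without `F''`. -/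
def secondJet (G H : E → E →L[ℝ] E →L[ℝ] ℝ) (ρ : E → ℝ) (y : E) (s t : ℝ) :
    E →L[ℝ] E →L[ℝ] E →L[ℝ] E →L[ℝ] ℝ :=
  fderiv ℝ (fderiv ℝ G) y + t • fderiv ℝ (dTensor ρ H) y + s • fderiv ℝ (fderiv ℝ H) y
    + t • (fderiv ℝ ρ y).smulRight (fderiv ℝ H y)

/-- The part of the curvature `R(v, x, x, v)` of `G + (F ∘ ρ) H` without `F''`, in terms of
`s = F (ρ y)` and `t = F' (ρ y)`. -/
def jetCurvature (G H : E → E →L[ℝ] E →L[ℝ] ℝ) (ρ : E → ℝ) (y : E) (s t : ℝ) (v x : E) : ℝ :=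
  koszulOp (secondJet G H ρ y s t v) x x v - koszulOp (secondJet G H ρ y s t x) v x v
    - koszulOp (firstJet G H ρ y s t) v v
        ((G y + s • H y).inverse (koszulOp (firstJet G H ρ y s t) x x))
    + koszulOp (firstJet G H ρ y s t) x v
        ((G y + s • H y).inverse (koszulOp (firstJet G H ρ y s t) v x))

variable {G H : E → E →L[ℝ] E →L[ℝ] ℝ} {ρ : E → ℝ} {y : E} {F : ℝ → ℝ}

theorem hasFDerivAt_comp_real (hρ : DifferentiableAt ℝ ρ y) (hF : DifferentiableAt ℝ F (ρ y)) :
    HasFDerivAt (fun z ↦ F (ρ z)) (deriv F (ρ y) • fderiv ℝ ρ y) y :=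
  hF.hasDerivAt.comp_hasFDerivAt y hρ.hasFDerivAt

theorem fderiv_add_comp_smul (hG : DifferentiableAt ℝ G y) (hH : DifferentiableAt ℝ H y)
    (hρ : DifferentiableAt ℝ ρ y) (hF : DifferentiableAt ℝ F (ρ y)) :
    fderiv ℝ (fun z ↦ G z + F (ρ z) • H z) y = firstJet G H ρ y (F (ρ y)) (deriv F (ρ y)) := by
  have h := hG.hasFDerivAt.fun_add ((hasFDerivAt_comp_real hρ hF).fun_smul hH.hasFDerivAt)
  rw [h.fderiv, firstJet, dTensor]
  ext u v w
  simp
  ring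

theorem contDiffAt_dTensor {n : ℕ∞ω} (hH : ContDiffAt ℝ n H y)
    (hρ : ContDiffAt ℝ (n + 1) ρ y) : ContDiffAt ℝ n (dTensor ρ H) y :=
  (hρ.fderiv_right le_rfl).smulRight hH

/-- Only the coefficient `F'(ρ)` of `dρ ⊗ H` yields `F''`, accompanied by another factor `dρ`;
differentiating the coefficient `F(ρ)` of `DH` gives the last summand of `secondJet`. -/
theorem fderiv_firstJet_comp (hG : ContDiffAt ℝ 2 G y) (hH : ContDiffAt ℝ 2 H y)
    (hρ : ContDiffAt ℝ 2 ρ y) (hF : ContDiff ℝ 2 F) (z : E) :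
    fderiv ℝ (fun z ↦ firstJet G H ρ z (F (ρ z)) (deriv F (ρ z))) y z
      = secondJet G H ρ y (F (ρ y)) (deriv F (ρ y)) z
        + (deriv (deriv F) (ρ y) * fderiv ℝ ρ y z) • dTensor ρ H y := by
  have h1 : ∀ {K : E → E →L[ℝ] E →L[ℝ] ℝ}, ContDiffAt ℝ 2 K y →
      HasFDerivAt (fderiv ℝ K) (fderiv ℝ (fderiv ℝ K) y) y := fun hK ↦
    ((hK.fderiv_right (m := 1) (by norm_num)).differentiableAt (by norm_num)).hasFDerivAt
  have hT : HasFDerivAt (dTensor ρ H) (fderiv ℝ (dTensor ρ H) y) y :=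
    ((contDiffAt_dTensor (n := 1) (hH.of_le (by norm_num))
      (hρ.of_le (by norm_num))).differentiableAt (by norm_num)).hasFDerivAt
  have hρ1 : DifferentiableAt ℝ ρ y := hρ.differentiableAt (by norm_num)
  have hF1 : Differentiable ℝ F := hF.differentiable (by norm_num)
  have hF2 : Differentiable ℝ (deriv F) :=
    (hF.iterate_deriv' 1 1).differentiable (by norm_num)
  have h := ((h1 hG).fun_add ((hasFDerivAt_comp_real hρ1 (hF2 _)).fun_smul hT)).fun_add
    ((hasFDerivAt_comp_real hρ1 (hF1 _)).fun_smul (h1 hH))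
  have h' : fderiv ℝ (fun z ↦ firstJet G H ρ z (F (ρ z)) (deriv F (ρ z))) y = _ := h.fderiv
  rw [h']
  ext a b c
  simp [secondJet]
  ring

/-- The curvature of `G + (F ∘ ρ) H`, with the part containing `F''` isolated. -/
theorem apply_coordCurvature_add_comp_smul [CompleteSpace E] (hG : ContDiffAt ℝ 2 G y)
    (hH : ContDiffAt ℝ 2 H y) (hρ : ContDiffAt ℝ 2 ρ y) (hF : ContDiff ℝ 2 F)
    (hGs : ∀ᶠ z in nhds y, ∀ v w, G z v w = G z w v)
    (hHs : ∀ᶠ z in nhds y, ∀ v w, H z v w = H z w v)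
    (hi : (G y + F (ρ y) • H y).IsInvertible) (v x : E) (hv : fderiv ℝ ρ y v = 0)
    (hx : fderiv ℝ ρ y x = 1) :
    (G y + F (ρ y) • H y) (coordCurvature (fun z ↦ G z + F (ρ z) • H z) y v x x) v
      = jetCurvature G H ρ y (F (ρ y)) (deriv F (ρ y)) v x
        - 1 / 2 * deriv (deriv F) (ρ y) * H y v v := by
  have hK : ContDiffAt ℝ 2 (fun z ↦ G z + F (ρ z) • H z) y :=
    hG.add ((hF.contDiffAt.comp y hρ).smul hH)
  have hs : ∀ᶠ z in nhds y, ∀ v w,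
      (G z + F (ρ z) • H z) v w = (G z + F (ρ z) • H z) w v := by
    filter_upwards [hGs, hHs] with z h1 h2 v w
    simp [h1 v w, h2 v w]
  have hd : fderiv ℝ (fun z ↦ G z + F (ρ z) • H z) =ᶠ[nhds y]
      fun z ↦ firstJet G H ρ z (F (ρ z)) (deriv F (ρ z)) := by
    filter_upwards [hG.eventually (by simp), hH.eventually (by simp),
      hρ.eventually (by simp)] with z h1 h2 h3
    exact fderiv_add_comp_smul (h1.differentiableAt (by norm_num))
      (h2.differentiableAt (by norm_num)) (h3.differentiableAt (by norm_num))
      (hF.differentiable (by norm_num) _)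
  have h := apply_coordCurvature hK hi hs v x x v
  rw [fderiv_koszul_apply hK, fderiv_koszul_apply hK, hd.fderiv_eq,
    fderiv_firstJet_comp hG hH hρ hF, fderiv_firstJet_comp hG hH hρ hF] at h
  simp only [koszul, hd.self_of_nhds] at h
  rw [h, jetCurvature, map_add, map_add, map_smul, map_smul]
  -- The `F''` term differentiated along `v` vanishes since `dρ(v) = 0`. The one along `x` enters
  -- with a minus sign, and of its three Koszul terms only `½ dρ(x) H(v, v)` survives.
  simp [koszulOp_apply, dTensor, hv, hx]
  ring

end Perturbation

/-! ### Uniform Lipschitz estimate and the curvature bound in coordinates -/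

section Estimate

set_option maxSynthPendingDepth 3

variable {E : Type*} [NormedAddCommGroup E] [NormedSpace ℝ E]

variable {G H : E → E →L[ℝ] E →L[ℝ] ℝ} {ρ : E → ℝ}

theorem jetCurvature_smul (y : E) (s t a : ℝ) (v x : E) :
    jetCurvature G H ρ y s t (a • v) x = a ^ 2 * jetCurvature G H ρ y s t v x := by
  simp only [jetCurvature, map_smul, smul_apply, smul_eq_mul]
  ring

set_option maxSynthPendingDepth 6 in
-- Three derivatives of the data make the second derivatives in `secondJet` of class `C¹`; apart
-- from these, the expression is built from multilinear operations and one inversion.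
theorem contDiffAt_jetCurvature [CompleteSpace E] {q₀ : E × ℝ × ℝ × E × E}
    (hG : ContDiffAt ℝ 3 G q₀.1) (hH : ContDiffAt ℝ 3 H q₀.1) (hρ : ContDiffAt ℝ 3 ρ q₀.1)
    (hi : (G q₀.1 + q₀.2.1 • H q₀.1).IsInvertible) :
    ContDiffAt ℝ 1 (fun q : E × ℝ × ℝ × E × E ↦
      jetCurvature G H ρ q.1 q.2.1 q.2.2.1 q.2.2.2.1 q.2.2.2.2) q₀ := by
  have hf : ContDiffAt ℝ 1 (fun q : E × ℝ × ℝ × E × E ↦ q.1) q₀ := contDiffAt_fst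
  have hs : ContDiffAt ℝ 1 (fun q : E × ℝ × ℝ × E × E ↦ q.2.1) q₀ := by fun_prop
  have ht : ContDiffAt ℝ 1 (fun q : E × ℝ × ℝ × E × E ↦ q.2.2.1) q₀ := by fun_prop
  have hv : ContDiffAt ℝ 1 (fun q : E × ℝ × ℝ × E × E ↦ q.2.2.2.1) q₀ := by fun_prop
  have hx : ContDiffAt ℝ 1 (fun q : E × ℝ × ℝ × E × E ↦ q.2.2.2.2) q₀ := by fun_prop
  have hG1 : ContDiffAt ℝ 2 (fderiv ℝ G) q₀.1 := hG.fderiv_right (by norm_num)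
  have hH1 : ContDiffAt ℝ 2 (fderiv ℝ H) q₀.1 := hH.fderiv_right (by norm_num)
  have hρ1 : ContDiffAt ℝ 2 (fderiv ℝ ρ) q₀.1 := hρ.fderiv_right (by norm_num)
  have hG2 : ContDiffAt ℝ 1 (fderiv ℝ (fderiv ℝ G)) q₀.1 := hG1.fderiv_right (by norm_num)
  have hH2 : ContDiffAt ℝ 1 (fderiv ℝ (fderiv ℝ H)) q₀.1 := hH1.fderiv_right (by norm_num)
  have hT : ContDiffAt ℝ 2 (dTensor ρ H) q₀.1 :=
    contDiffAt_dTensor (hH.of_le (by norm_num)) (hρ.of_le (by norm_num))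
  have hT1 : ContDiffAt ℝ 1 (fderiv ℝ (dTensor ρ H)) q₀.1 := hT.fderiv_right (by norm_num)
  have c1 : ContDiffAt ℝ 1 (fun q : E × ℝ × ℝ × E × E ↦ firstJet G H ρ q.1 q.2.1 q.2.2.1) q₀ :=
    (((hG1.of_le (by norm_num)).comp q₀ hf).add
      (ht.smul ((hT.of_le (by norm_num)).comp q₀ hf))).add
      (hs.smul ((hH1.of_le (by norm_num)).comp q₀ hf))
  have c2 : ContDiffAt ℝ 1 (fun q : E × ℝ × ℝ × E × E ↦ secondJet G H ρ q.1 q.2.1 q.2.2.1) q₀ :=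
    (((hG2.comp q₀ hf).add (ht.smul (hT1.comp q₀ hf))).add (hs.smul (hH2.comp q₀ hf))).add
      (ht.smul (((hρ1.of_le (by norm_num)).comp q₀ hf).smulRight
        ((hH1.of_le (by norm_num)).comp q₀ hf)))
  have c' : ContDiffAt ℝ 1 (fun q : E × ℝ × ℝ × E × E ↦ G q.1 + q.2.1 • H q.1) q₀ :=
    ((hG.of_le (by norm_num)).comp q₀ hf).add (hs.smul ((hH.of_le (by norm_num)).comp q₀ hf))
  have c0 : ContDiffAt ℝ 1 (fun q : E × ℝ × ℝ × E × E ↦ (G q.1 + q.2.1 • H q.1).inverse) q₀ :=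
    ContDiffAt.comp (g := ContinuousLinearMap.inverse) q₀ hi.contDiffAt_map_inverse c'
  have k1 := (koszulOp (E := E)).contDiff.contDiffAt.comp q₀ c1
  have k2v := (koszulOp (E := E)).contDiff.contDiffAt.comp q₀ (c2.clm_apply hv)
  have k2x := (koszulOp (E := E)).contDiff.contDiffAt.comp q₀ (c2.clm_apply hx)
  exact (((((k2v.clm_apply hx).clm_apply hx).clm_apply hv).sub
    (((k2x.clm_apply hv).clm_apply hx).clm_apply hv)).sub
    (((k1.clm_apply hv).clm_apply hv).clm_apply
      (c0.clm_apply ((k1.clm_apply hx).clm_apply hx)))).add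
    (((k1.clm_apply hx).clm_apply hv).clm_apply
      (c0.clm_apply ((k1.clm_apply hv).clm_apply hx)))

/-- For negative `s` the comparison `B ≤ A` gives `A + s B ≥ (1 + s) A`. With `s = φ² - 1` the
condition `-1 < s` says `φ ≠ 0`. -/
theorem add_smul_posDef {A B : E →L[ℝ] E →L[ℝ] ℝ} (hA : ∀ v, v ≠ 0 → 0 < A v v)
    (hB : ∀ v, 0 ≤ B v v) (hBA : ∀ v, B v v ≤ A v v) {s : ℝ} (hs : -1 < s) (v : E) (hv : v ≠ 0) :
    0 < (A + s • B) v v := by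
  have h1 := hA v hv
  have h2 := hB v
  have h3 := hBA v
  simp only [add_apply, smul_apply, smul_eq_mul]
  rcases le_or_gt 0 s with h | h
  · positivity
  · nlinarith

/-- A continuous field of positive definite forms is locally uniformly positive definite. -/
theorem exists_norm_sq_le_of_posDef [FiniteDimensional ℝ E] {y₀ : E} (hG : ContinuousAt G y₀)
    (hpos : ∀ v, v ≠ 0 → 0 < G y₀ v v) :
    ∃ c : ℝ, 0 < c ∧ ∀ᶠ y in nhds y₀, ∀ v, ‖v‖ ^ 2 ≤ c ^ 2 * G y v v := by
  obtain ⟨m, hm, hmv⟩ : ∃ m : ℝ, 0 < m ∧ ∀ v, m * ‖v‖ ^ 2 ≤ G y₀ v v := by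
    rcases subsingleton_or_nontrivial E with hE | hE
    · exact ⟨1, one_pos, fun v ↦ by simp [Subsingleton.elim v 0]⟩
    have hcont : Continuous fun v ↦ G y₀ v v := by fun_prop
    obtain ⟨u, hu, hmin⟩ := (isCompact_sphere (0 : E) 1).exists_isMinOn
      (NormedSpace.sphere_nonempty.2 zero_le_one) hcont.continuousOn
    have hu1 : ‖u‖ = 1 := by simpa using hu
    refine ⟨G y₀ u u, hpos u (by rintro rfl; simp at hu1), fun v ↦ ?_⟩
    rcases eq_or_ne v 0 with rfl | hv
    · simp
    have hn : ‖v‖ ≠ 0 := norm_ne_zero_iff.2 hv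
    have h1 : G y₀ u u ≤ G y₀ (‖v‖⁻¹ • v) (‖v‖⁻¹ • v) :=
      hmin (by simp [norm_smul, hn])
    simp only [map_smul, smul_apply, smul_eq_mul] at h1
    calc G y₀ u u * ‖v‖ ^ 2 ≤ (‖v‖⁻¹ * (‖v‖⁻¹ * G y₀ v v)) * ‖v‖ ^ 2 := by gcongr
      _ = G y₀ v v := by field_simp
  -- Here `m` bounds `G` at `y₀` from below on unit vectors; nearby, half of it is lost at most.
  refine ⟨Real.sqrt (2 / m), by positivity, ?_⟩
  have hev : ∀ᶠ y in nhds y₀, ‖G y - G y₀‖ < m / 2 := by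
    have := hG.eventually (Metric.ball_mem_nhds (G y₀) (half_pos hm))
    simpa only [Metric.mem_ball, dist_eq_norm] using this
  filter_upwards [hev] with y hy v
  have h1 : |(G y - G y₀) v v| ≤ m / 2 * ‖v‖ ^ 2 := by
    calc |(G y - G y₀) v v| ≤ ‖G y - G y₀‖ * ‖v‖ * ‖v‖ := (G y - G y₀).le_opNorm₂ v v
      _ ≤ m / 2 * ‖v‖ * ‖v‖ := by gcongr
      _ = m / 2 * ‖v‖ ^ 2 := by ring
  simp only [sub_apply] at h1
  have h2 := (abs_le.1 h1).1
  have h3 := hmv v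
  rw [Real.sq_sqrt (by positivity)]
  have h4 : m / 2 * ‖v‖ ^ 2 ≤ G y v v := by linarith
  calc ‖v‖ ^ 2 = 2 / m * (m / 2 * ‖v‖ ^ 2) := by field_simp
    _ ≤ 2 / m * G y v v := by gcongr

/-- A `C¹` function is Lipschitz on a compact convex set, and vectors that are unit for `G` stay in
a fixed ball. The ranges of `s` and `t` are those of `f² - 1` and `2 f f'` for `|1 - f| ≤ 1/2` and
`|f'| ≤ 1/2`. -/
theorem exists_jetCurvature_lipschitz [FiniteDimensional ℝ E] {y₀ : E}
    (hG : ContDiffAt ℝ 3 G y₀) (hH : ContDiffAt ℝ 3 H y₀) (hρ : ContDiffAt ℝ 3 ρ y₀)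
    (hGp : ∀ᶠ z in nhds y₀, ∀ v, v ≠ 0 → 0 < G z v v)
    (hH0 : ∀ᶠ z in nhds y₀, ∀ v, 0 ≤ H z v v)
    (hHG : ∀ᶠ z in nhds y₀, ∀ v, H z v v ≤ G z v v) :
    ∃ K : ℝ, 0 ≤ K ∧ ∀ᶠ y in nhds y₀, ∀ s ∈ Set.Icc (-3 / 4 : ℝ) (5 / 4),
      ∀ t ∈ Set.Icc (-3 / 2 : ℝ) (3 / 2), ∀ v x, G y x x = 1 →
      |jetCurvature G H ρ y s t v x - jetCurvature G H ρ y 0 0 v x|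
        ≤ K * max |s| |t| * G y v v := by
  have : CompleteSpace E := FiniteDimensional.complete ℝ E
  have : ProperSpace E := FiniteDimensional.proper ℝ E
  obtain ⟨c, hc, hcv⟩ := exists_norm_sq_le_of_posDef hG.continuousAt hGp.self_of_nhds
  have hreg : ∀ᶠ y in nhds y₀, ContDiffAt ℝ 3 G y ∧ ContDiffAt ℝ 3 H y ∧ ContDiffAt ℝ 3 ρ y ∧
      ∀ s : ℝ, -1 < s → (G y + s • H y).IsInvertible := by
    filter_upwards [hG.eventually (by simp), hH.eventually (by simp), hρ.eventually (by simp),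
      hGp, hH0, hHG] with y h1 h2 h3 h4 h5 h6
    exact ⟨h1, h2, h3, fun s hs ↦ isInvertible_of_posDef (add_smul_posDef h4 h5 h6 hs)⟩
  obtain ⟨ε, hε, hball⟩ := Metric.nhds_basis_closedBall.eventually_iff.1 hreg
  let D : Set (E × ℝ × ℝ × E × E) := Metric.closedBall y₀ ε ×ˢ Set.Icc (-3 / 4 : ℝ) (5 / 4) ×ˢ
    Set.Icc (-3 / 2 : ℝ) (3 / 2) ×ˢ Metric.closedBall 0 c ×ˢ Metric.closedBall 0 c
  have hD : IsCompact D := (isCompact_closedBall _ _).prod (isCompact_Icc.prod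
    (isCompact_Icc.prod ((isCompact_closedBall _ _).prod (isCompact_closedBall _ _))))
  have hDc : Convex ℝ D := (convex_closedBall _ _).prod ((convex_Icc _ _).prod
    ((convex_Icc _ _).prod ((convex_closedBall _ _).prod (convex_closedBall _ _))))
  have hΨ : ContDiffOn ℝ 1 (fun q : E × ℝ × ℝ × E × E ↦
      jetCurvature G H ρ q.1 q.2.1 q.2.2.1 q.2.2.2.1 q.2.2.2.2) D := by
    intro q hq
    obtain ⟨h1, h2, h3, h4⟩ := hball hq.1
    exact (contDiffAt_jetCurvature h1 h2 h3
      (h4 _ (lt_of_lt_of_le (by norm_num) hq.2.1.1))).contDiffWithinAt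
  obtain ⟨K, hK⟩ := hΨ.exists_lipschitzOnWith one_ne_zero hDc hD
  refine ⟨K, K.2, ?_⟩
  filter_upwards [hcv, hGp, Metric.closedBall_mem_nhds y₀ hε] with y hy hyp hyε s hs t ht v x hx
  have hunit : ∀ u, G y u u = 1 → u ∈ Metric.closedBall (0 : E) c := by
    intro u hu
    have := hy u
    rw [hu, mul_one] at this
    simpa using abs_le_of_sq_le_sq this hc.le
  have main : ∀ u, G y u u = 1 →
      |jetCurvature G H ρ y s t u x - jetCurvature G H ρ y 0 0 u x| ≤ K * max |s| |t| := by
    intro u hu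
    -- The two points differ only in `s` and `t`, so their distance in the product is `max |s| |t|`.
    have h := hK.dist_le_mul (y, s, t, u, x) ⟨hyε, hs, ht, hunit u hu, hunit x hx⟩
      (y, 0, 0, u, x) ⟨hyε, by norm_num, by norm_num, hunit u hu, hunit x hx⟩
    simpa [Prod.dist_eq, Real.dist_eq] using h
  rcases eq_or_ne v 0 with rfl | hv
  · have h0 : ∀ s t, jetCurvature G H ρ y s t 0 x = 0 := fun s t ↦ by
      simpa using jetCurvature_smul (G := G) (H := H) (ρ := ρ) y s t 0 0 x
    simp [h0]
  have hg := hyp v hv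
  -- Both sides are quadratic in `v`, which reduces the bound to a unit vector.
  set a := Real.sqrt (G y v v) with ha
  have ha2 : a ^ 2 = G y v v := Real.sq_sqrt hg.le
  have ha0 : a ≠ 0 := (Real.sqrt_pos.2 hg).ne'
  have hu : G y (a⁻¹ • v) (a⁻¹ • v) = 1 := by
    simp only [map_smul, smul_apply, smul_eq_mul, ← ha2]
    field_simp
  have h := main _ hu
  rw [jetCurvature_smul, jetCurvature_smul, ← mul_sub, abs_mul, abs_of_nonneg (by positivity),
    inv_pow, inv_mul_le_iff₀ (by positivity), ha2] at h
  linarith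

/-- The effect of the partial conformal change on curvature, in coordinates. -/
theorem exists_coordCurvature_bound [FiniteDimensional ℝ E] {y₀ : E}
    (hG : ContDiffAt ℝ 3 G y₀) (hH : ContDiffAt ℝ 3 H y₀) (hρ : ContDiffAt ℝ 3 ρ y₀)
    (hGs : ∀ᶠ z in nhds y₀, ∀ v w, G z v w = G z w v)
    (hHs : ∀ᶠ z in nhds y₀, ∀ v w, H z v w = H z w v)
    (hGp : ∀ᶠ z in nhds y₀, ∀ v, v ≠ 0 → 0 < G z v v)
    (hH0 : ∀ᶠ z in nhds y₀, ∀ v, 0 ≤ H z v v)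
    (hHG : ∀ᶠ z in nhds y₀, ∀ v, H z v v ≤ G z v v) :
    ∃ C : ℝ, ∀ᶠ y in nhds y₀, ∀ f : ℝ → ℝ, ContDiff ℝ 2 f →
      max |1 - f (ρ y)| |deriv f (ρ y)| ≤ 1 / 2 →
      ∀ v x, fderiv ℝ ρ y v = 0 → fderiv ℝ ρ y x = 1 → G y x x = 1 → H y v v = G y v v →
      |(G y + (f (ρ y) ^ 2 - 1) • H y)
          (coordCurvature (fun z ↦ G z + (f (ρ z) ^ 2 - 1) • H z) y v x x) v
        - (G y (coordCurvature G y v x x) v - deriv (deriv f) (ρ y) * G y v v)|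
      ≤ (C + |deriv (deriv f) (ρ y)|) * max |1 - f (ρ y)| |deriv f (ρ y)| * G y v v := by
  have : CompleteSpace E := FiniteDimensional.complete ℝ E
  obtain ⟨K, hK0, hK⟩ := exists_jetCurvature_lipschitz hG hH hρ hGp hH0 hHG
  -- The part `3 K` comes from `|s|, |t| ≤ 3 δ`, and the `1` from `f'² ≤ δ`. The separate `|f''|` in
  -- the bound comes from `(1 - f) f''`.
  refine ⟨3 * K + 1, ?_⟩
  filter_upwards [hK, hG.eventually (by simp), hH.eventually (by simp), hρ.eventually (by simp),
    hGs.eventually_nhds, hHs.eventually_nhds, hGp, hH0, hHG] with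
    y hKy hGy hHy hρy hGsy hHsy hGpy hH0y hHGy f hf hδ v x hv hx hxx hvv
  set δ := max |1 - f (ρ y)| |deriv f (ρ y)| with hδd
  have hδ1 : |1 - f (ρ y)| ≤ δ := le_max_left _ _
  have hδ2 : |deriv f (ρ y)| ≤ δ := le_max_right _ _
  have hδ0 : 0 ≤ δ := (abs_nonneg _).trans hδ1
  obtain ⟨a1, a2⟩ := abs_le.1 hδ1
  obtain ⟨b1, b2⟩ := abs_le.1 hδ2
  have hfd : Differentiable ℝ f := hf.differentiable (by norm_num)
  have hfd' : Differentiable ℝ (deriv f) := (hf.iterate_deriv' 1 1).differentiable (by norm_num)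
  have hF : ContDiff ℝ 2 fun t ↦ f t ^ 2 - 1 := (hf.pow 2).sub contDiff_const
  have hF1 : deriv (fun t ↦ f t ^ 2 - 1) = fun t ↦ 2 * f t * deriv f t := by
    ext t
    have := (((hfd t).hasDerivAt.pow 2).sub_const 1).deriv
    simpa using this
  have hF2 : deriv (deriv fun t ↦ f t ^ 2 - 1) (ρ y)
      = 2 * deriv f (ρ y) ^ 2 + 2 * f (ρ y) * deriv (deriv f) (ρ y) := by
    rw [hF1]
    have := (((hfd (ρ y)).hasDerivAt.const_mul 2).mul (hfd' (ρ y)).hasDerivAt).deriv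
    rw [show (fun t ↦ 2 * f t * deriv f t) = (fun t ↦ 2 * f t) * deriv f from rfl, this]
    ring
  have e1 := apply_coordCurvature_add_comp_smul (hGy.of_le (by norm_num))
    (hHy.of_le (by norm_num)) (hρy.of_le (by norm_num)) hF hGsy hHsy
    (isInvertible_of_posDef (add_smul_posDef hGpy hH0y hHGy (by nlinarith))) v x hv hx
  -- With `F = 0` the same formula identifies the unperturbed curvature with `jetCurvature` at `s =
  -- t = 0`.
  have e2 := apply_coordCurvature_add_comp_smul (F := fun _ ↦ 0) (hGy.of_le (by norm_num))
    (hHy.of_le (by norm_num)) (hρy.of_le (by norm_num)) contDiff_const hGsy hHsy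
    (isInvertible_of_posDef (add_smul_posDef hGpy hH0y hHGy (by norm_num))) v x hv hx
  simp only [zero_smul, add_zero, deriv_const', mul_zero, zero_mul, sub_zero] at e2
  rw [hF2] at e1
  simp only [hF1] at e1
  have hs : |f (ρ y) ^ 2 - 1| ≤ 3 * δ := by
    rw [abs_le]; constructor <;> nlinarith
  have ht : |2 * f (ρ y) * deriv f (ρ y)| ≤ 3 * δ := by
    rw [abs_le]; constructor <;> nlinarith
  have hL := hKy (f (ρ y) ^ 2 - 1) ⟨by nlinarith, by nlinarith⟩ (2 * f (ρ y) * deriv f (ρ y))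
    ⟨by nlinarith, by nlinarith⟩ v x hxx
  have hg : 0 ≤ G y v v := hvv ▸ hH0y v
  have hL' : K * max |f (ρ y) ^ 2 - 1| |2 * f (ρ y) * deriv f (ρ y)| * G y v v
      ≤ K * (3 * δ) * G y v v := by
    gcongr
    exact max_le hs ht
  rw [e1, e2, hvv]
  set A := jetCurvature G H ρ y (f (ρ y) ^ 2 - 1) (2 * f (ρ y) * deriv f (ρ y)) v x
  set B := jetCurvature G H ρ y 0 0 v x
  have hq : |(1 - f (ρ y)) * deriv (deriv f) (ρ y) - deriv f (ρ y) ^ 2|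
      ≤ (1 + |deriv (deriv f) (ρ y)|) * δ := by
    calc _ ≤ |(1 - f (ρ y)) * deriv (deriv f) (ρ y)| + |deriv f (ρ y) ^ 2| := abs_sub _ _
      _ ≤ δ * |deriv (deriv f) (ρ y)| + δ := by
        rw [abs_mul, abs_pow]
        gcongr
        nlinarith [abs_nonneg (deriv f (ρ y))]
      _ = _ := by ring
  calc _ = |(A - B) + ((1 - f (ρ y)) * deriv (deriv f) (ρ y) - deriv f (ρ y) ^ 2) * G y v v| := by
        congr 1; ring
    _ ≤ |A - B| + |(1 - f (ρ y)) * deriv (deriv f) (ρ y) - deriv f (ρ y) ^ 2| * G y v v := by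
        rw [← abs_of_nonneg hg, ← abs_mul, abs_of_nonneg hg]; exact abs_add_le _ _
    _ ≤ K * (3 * δ) * G y v v + (1 + |deriv (deriv f) (ρ y)|) * δ * G y v v := by
        gcongr
        exact hL.trans hL'
    _ = _ := by ring

end Estimate

/-! ### Metrics, functions and curvature in an arbitrary chart -/

section Charts

set_option maxSynthPendingDepth 3

variable {E : Type*} [NormedAddCommGroup E] [NormedSpace ℝ E]
  {M : Type*} [TopologicalSpace M] [ChartedSpace E M]

theorem metricInChart_apply
    (B : ∀ q : M, TangentSpace 𝓘(ℝ, E) q →L[ℝ] TangentSpace 𝓘(ℝ, E) q →L[ℝ] ℝ)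
    (e : OpenPartialHomeomorph M E) (y a b : E) :
    metricInChart B e y a b = B (e.symm y) (mfderiv 𝓘(ℝ, E) 𝓘(ℝ, E) e.symm y a)
      (mfderiv 𝓘(ℝ, E) 𝓘(ℝ, E) e.symm y b) := rfl

theorem contDiffAt_bilin_pullback {n : ℕ∞ω} {G : E → E →L[ℝ] E →L[ℝ] ℝ} {A : E → E →L[ℝ] E}
    {y : E} (hG : ContDiffAt ℝ n G y) (hA : ContDiffAt ℝ n A y) :
    ContDiffAt ℝ n (fun z ↦ (G z).bilinearComp (A z) (A z)) y := by
  have hf : ContDiff ℝ n (fun L : E →L[ℝ] E →L[ℝ] ℝ ↦ L.flip) :=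
    (ContinuousLinearMap.flipₗᵢ ℝ E E ℝ).toContinuousLinearEquiv.contDiff
  exact hf.contDiffAt.comp y ((hf.contDiffAt.comp y (hG.clm_comp hA)).clm_comp hA)

variable [IsManifold 𝓘(ℝ, E) ∞ M]

theorem mdifferentiable_chartAt (p : M) :
    (chartAt E p).MDifferentiable 𝓘(ℝ, E) 𝓘(ℝ, E) :=
  have : IsManifold 𝓘(ℝ, E) 1 M := .of_le (n := ∞) (by simp)
  mdifferentiable_chart p

theorem contDiffAt_chart_transition (p₀ p : M) {y : E} (hy : y ∈ (chartAt E p).target)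
    (hy' : (chartAt E p).symm y ∈ (chartAt E p₀).source) :
    ContDiffAt ℝ ∞ (chartAt E p₀ ∘ (chartAt E p).symm) y := by
  have h1 : ContMDiffAt 𝓘(ℝ, E) 𝓘(ℝ, E) ∞ (chartAt E p).symm y :=
    (contMDiffOn_chart_symm (I := 𝓘(ℝ, E)) (x := p)).contMDiffAt
      ((chartAt E p).open_target.mem_nhds hy)
  have h2 : ContMDiffAt 𝓘(ℝ, E) 𝓘(ℝ, E) ∞ (chartAt E p₀) ((chartAt E p).symm y) :=
    (contMDiffOn_chart (I := 𝓘(ℝ, E)) (x := p₀)).contMDiffAt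
      ((chartAt E p₀).open_source.mem_nhds hy')
  exact (h2.comp y h1).contDiffAt

theorem fderiv_chart_transition (p₀ p : M) {y : E} (hy : y ∈ (chartAt E p).target)
    (hy' : (chartAt E p).symm y ∈ (chartAt E p₀).source) (a : E) :
    (fderiv ℝ (chartAt E p₀ ∘ (chartAt E p).symm) y a : E)
      = mfderiv 𝓘(ℝ, E) 𝓘(ℝ, E) (chartAt E p₀) ((chartAt E p).symm y)
        (mfderiv 𝓘(ℝ, E) 𝓘(ℝ, E) (chartAt E p).symm y a) := by
  rw [← mfderiv_eq_fderiv, mfderiv_comp y ((mdifferentiable_chartAt p₀).mdifferentiableAt hy')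
    ((mdifferentiable_chartAt p).mdifferentiableAt_symm hy)]
  rfl

theorem mfderiv_symm_mfderiv_chart (p₀ : M) {p : M} (hp : p ∈ (chartAt E p₀).source)
    (v : TangentSpace 𝓘(ℝ, E) p) :
    mfderiv 𝓘(ℝ, E) 𝓘(ℝ, E) (chartAt E p₀).symm (chartAt E p₀ p)
      (mfderiv 𝓘(ℝ, E) 𝓘(ℝ, E) (chartAt E p₀) p v) = v :=
  congrArg (fun L : TangentSpace 𝓘(ℝ, E) p →L[ℝ] TangentSpace 𝓘(ℝ, E) p ↦ L v)
    ((mdifferentiable_chartAt p₀).symm_comp_deriv hp)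

theorem mfderiv_chart_symm_eq (p₀ p : M) {y : E} (hy : y ∈ (chartAt E p).target)
    (hy' : (chartAt E p).symm y ∈ (chartAt E p₀).source) (a : E) :
    (mfderiv 𝓘(ℝ, E) 𝓘(ℝ, E) (chartAt E p₀).symm (chartAt E p₀ ((chartAt E p).symm y))
      (fderiv ℝ (chartAt E p₀ ∘ (chartAt E p).symm) y a) : E)
      = mfderiv 𝓘(ℝ, E) 𝓘(ℝ, E) (chartAt E p).symm y a := by
  rw [fderiv_chart_transition p₀ p hy hy']
  exact mfderiv_symm_mfderiv_chart p₀ hy' _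

theorem metricInChart_transition
    (B : ∀ q : M, TangentSpace 𝓘(ℝ, E) q →L[ℝ] TangentSpace 𝓘(ℝ, E) q →L[ℝ] ℝ)
    (p₀ p : M) {y : E} (hy : y ∈ (chartAt E p).target)
    (hy' : (chartAt E p).symm y ∈ (chartAt E p₀).source) (a b : E) :
    metricInChart B (chartAt E p) y a b
      = metricInChart B (chartAt E p₀) ((chartAt E p₀ ∘ (chartAt E p).symm) y)
        (fderiv ℝ (chartAt E p₀ ∘ (chartAt E p).symm) y a)
        (fderiv ℝ (chartAt E p₀ ∘ (chartAt E p).symm) y b) := by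
  rw [metricInChart_apply, metricInChart_apply]
  have hB : ∀ q q' : M, q = q' → ∀ u v : E, (B q : E →L[ℝ] E →L[ℝ] ℝ) u v
    = (B q' : E →L[ℝ] E →L[ℝ] ℝ) u v := by rintro q _ rfl u v; rfl
  have h := hB _ _ ((chartAt E p₀).left_inv hy')
    (mfderiv 𝓘(ℝ, E) 𝓘(ℝ, E) (chartAt E p).symm y a)
    (mfderiv 𝓘(ℝ, E) 𝓘(ℝ, E) (chartAt E p).symm y b)
  refine h.symm.trans ?_
  rw [← mfderiv_chart_symm_eq p₀ p hy hy' a, ← mfderiv_chart_symm_eq p₀ p hy hy' b]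
  rfl

theorem eq_zero_of_mfderiv_chart_symm (p : M) {y : E} (hy : y ∈ (chartAt E p).target) {a : E}
    (ha : (mfderiv 𝓘(ℝ, E) 𝓘(ℝ, E) (chartAt E p).symm y a : E) = 0) : a = 0 := by
  have h2 := congrArg (fun L : E →L[ℝ] E ↦ L a)
    ((mdifferentiable_chartAt p).comp_symm_deriv hy)
  have h3 : (mfderiv 𝓘(ℝ, E) 𝓘(ℝ, E) (chartAt E p) ((chartAt E p).symm y)
    (mfderiv 𝓘(ℝ, E) 𝓘(ℝ, E) (chartAt E p).symm y a) : E) = a := h2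
  rw [← h3]
  refine (congrArg _ ha).trans (map_zero _)

theorem isInvertible_fderiv_chart_transition [FiniteDimensional ℝ E] (p₀ p : M) {y : E}
    (hy : y ∈ (chartAt E p).target)
    (hy' : (chartAt E p).symm y ∈ (chartAt E p₀).source) :
    (fderiv ℝ (chartAt E p₀ ∘ (chartAt E p).symm) y).IsInvertible := by
  have hinj : Function.Injective
      (fderiv ℝ (chartAt E p₀ ∘ (chartAt E p).symm) y).toLinearMap := by
    rw [injective_iff_map_eq_zero]
    intro a ha
    have h0 : fderiv ℝ (chartAt E p₀ ∘ (chartAt E p).symm) y a = 0 := ha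
    have h1 := mfderiv_chart_symm_eq p₀ p hy hy' a
    rw [h0] at h1
    refine eq_zero_of_mfderiv_chart_symm p hy ?_
    rw [← h1]
    exact map_zero _
  exact ⟨(LinearEquiv.ofInjectiveEndo _ hinj).toContinuousLinearEquiv, by ext; rfl⟩

/-- The curvature tensor can be computed in any chart. -/
theorem curvatureTensor_eq_chart [FiniteDimensional ℝ E]
    (B : ∀ q : M, TangentSpace 𝓘(ℝ, E) q →L[ℝ] TangentSpace 𝓘(ℝ, E) q →L[ℝ] ℝ)
    (p₀ : M) {p : M} (hp : p ∈ (chartAt E p₀).source)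
    (hB : ContDiffAt ℝ 2 (metricInChart B (chartAt E p₀)) (chartAt E p₀ p))
    (hs : ∀ᶠ z in nhds (chartAt E p₀ p), ∀ v w,
      metricInChart B (chartAt E p₀) z v w = metricInChart B (chartAt E p₀) z w v)
    (hpos : ∀ v, v ≠ 0 → 0 < metricInChart B (chartAt E p₀) (chartAt E p₀ p) v v)
    (a b c d : TangentSpace 𝓘(ℝ, E) p) :
    curvatureTensor B p a b c d
      = metricInChart B (chartAt E p₀) (chartAt E p₀ p)
        (coordCurvature (metricInChart B (chartAt E p₀)) (chartAt E p₀ p)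
          (mfderiv 𝓘(ℝ, E) 𝓘(ℝ, E) (chartAt E p₀) p a)
          (mfderiv 𝓘(ℝ, E) 𝓘(ℝ, E) (chartAt E p₀) p b)
          (mfderiv 𝓘(ℝ, E) 𝓘(ℝ, E) (chartAt E p₀) p c))
        (mfderiv 𝓘(ℝ, E) 𝓘(ℝ, E) (chartAt E p₀) p d) := by
  have : CompleteSpace E := FiniteDimensional.complete ℝ E
  have hpp : p ∈ (chartAt E p).source := mem_chart_source E p
  have hsp : (chartAt E p).symm (chartAt E p p) = p := (chartAt E p).left_inv hpp
  have hyt : chartAt E p p ∈ (chartAt E p).target := (chartAt E p).map_source hpp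
  have hys : (chartAt E p).symm (chartAt E p p) ∈ (chartAt E p₀).source := by rwa [hsp]
  set Φ : E → E := chartAt E p₀ ∘ (chartAt E p).symm with hΦd
  have hΦy : Φ (chartAt E p p) = chartAt E p₀ p := congrArg (chartAt E p₀) hsp
  have hΦ : ContDiffAt ℝ ∞ Φ (chartAt E p p) := contDiffAt_chart_transition p₀ p hyt hys
  have hA := isInvertible_fderiv_chart_transition p₀ p hyt hys
  have hT : ∀ v : TangentSpace 𝓘(ℝ, E) p,
      fderiv ℝ Φ (chartAt E p p) (mfderiv 𝓘(ℝ, E) 𝓘(ℝ, E) (chartAt E p) p v)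
        = mfderiv 𝓘(ℝ, E) 𝓘(ℝ, E) (chartAt E p₀) p v := by
    intro v
    have hcomp : ∀ q : M, q = p → (mfderiv 𝓘(ℝ, E) 𝓘(ℝ, E) (chartAt E p₀) q : E →L[ℝ] E)
      = (mfderiv 𝓘(ℝ, E) 𝓘(ℝ, E) (chartAt E p₀) p : E →L[ℝ] E) := by rintro q rfl; rfl
    refine (fderiv_chart_transition p₀ p hyt hys _).trans ?_
    have h1 := mfderiv_symm_mfderiv_chart p hpp v
    refine Eq.trans ?_ (congrArg (fun L : E →L[ℝ] E ↦ L v) (hcomp _ hsp))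
    exact congrArg _ h1
  have hev : ∀ᶠ y in nhds (chartAt E p p), y ∈ (chartAt E p).target ∧
      (chartAt E p).symm y ∈ (chartAt E p₀).source := by
    refine Filter.Eventually.and ((chartAt E p).open_target.mem_nhds hyt) ?_
    exact ((chartAt E p).continuousAt_symm hyt).eventually
      ((chartAt E p₀).open_source.mem_nhds hys)
  have hG : ∀ᶠ y in nhds (chartAt E p p), ∀ v w, metricInChart B (chartAt E p) y v w
      = metricInChart B (chartAt E p₀) (Φ y) (fderiv ℝ Φ y v) (fderiv ℝ Φ y w) :=
    hev.mono fun y hy v w ↦ metricInChart_transition B p₀ p hy.1 hy.2 v w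
  rw [← hΦy] at hB hs hpos
  have hGd : ContDiffAt ℝ 2 (metricInChart B (chartAt E p)) (chartAt E p p) := by
    have h1 : ContDiffAt ℝ 2 (fun y ↦ metricInChart B (chartAt E p₀) (Φ y)) (chartAt E p p) :=
      hB.comp _ (hΦ.of_le (by norm_cast))
    refine (contDiffAt_bilin_pullback h1
      (hΦ.fderiv_right (m := 2) (by norm_cast))).congr_of_eventuallyEq ?_
    filter_upwards [hG] with y hy
    ext v w
    exact hy v w
  have hi : (metricInChart B (chartAt E p) (chartAt E p p)).IsInvertible := by
    refine isInvertible_of_posDef fun v hv ↦ ?_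
    rw [hG.self_of_nhds]
    refine hpos _ fun h0 ↦ hv (hA.bijective.injective (h0.trans (map_zero _).symm))
  have key := fderiv_coordCurvature_pullback (hΦ.of_le (by norm_cast)) hA hB
    (isInvertible_of_posDef hpos) hs hG hGd hi
  -- Stated for arbitrary vectors of `E`, so that the base point can be replaced without disturbing
  -- the tangent space types.
  have gen : ∀ u v w x u' v' w' x' : E, fderiv ℝ Φ (chartAt E p p) u = u' →
      fderiv ℝ Φ (chartAt E p p) v = v' → fderiv ℝ Φ (chartAt E p p) w = w' →
      fderiv ℝ Φ (chartAt E p p) x = x' →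
      metricInChart B (chartAt E p) (chartAt E p p)
        (coordCurvature (metricInChart B (chartAt E p)) (chartAt E p p) u v w) x
      = metricInChart B (chartAt E p₀) (Φ (chartAt E p p))
        (coordCurvature (metricInChart B (chartAt E p₀)) (Φ (chartAt E p p)) u' v' w') x' := by
    rintro u v w x _ _ _ _ rfl rfl rfl rfl
    rw [hG.self_of_nhds, key]
  rw [hΦy] at gen
  exact gen _ _ _ _ _ _ _ _ (hT a) (hT b) (hT c) (hT d)

theorem metricInChart_mfderiv_chart
    (B : ∀ q : M, TangentSpace 𝓘(ℝ, E) q →L[ℝ] TangentSpace 𝓘(ℝ, E) q →L[ℝ] ℝ)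
    (p₀ : M) {p : M} (hp : p ∈ (chartAt E p₀).source) (v w : TangentSpace 𝓘(ℝ, E) p) :
    metricInChart B (chartAt E p₀) (chartAt E p₀ p)
      (mfderiv 𝓘(ℝ, E) 𝓘(ℝ, E) (chartAt E p₀) p v)
      (mfderiv 𝓘(ℝ, E) 𝓘(ℝ, E) (chartAt E p₀) p w) = B p v w := by
  have hB : ∀ q : M, q = p → ∀ u u' v v' : E, u = u' → v = v' →
      (B q : E →L[ℝ] E →L[ℝ] ℝ) u v = (B p : E →L[ℝ] E →L[ℝ] ℝ) u' v' := by
    rintro q rfl u _ v _ rfl rfl; rfl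
  exact hB _ ((chartAt E p₀).left_inv hp) _ _ _ _ (mfderiv_symm_mfderiv_chart p₀ hp v)
    (mfderiv_symm_mfderiv_chart p₀ hp w)

theorem contDiffAt_comp_chart_symm {r : M → ℝ} (p₀ : M) {p : M} (hp : p ∈ (chartAt E p₀).source)
    (hr : ContMDiffAt 𝓘(ℝ, E) 𝓘(ℝ, ℝ) ∞ r p) :
    ContDiffAt ℝ ∞ (r ∘ (chartAt E p₀).symm) (chartAt E p₀ p) := by
  have hs : ContMDiffAt 𝓘(ℝ, E) 𝓘(ℝ, E) ∞ (chartAt E p₀).symm (chartAt E p₀ p) :=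
    (contMDiffOn_chart_symm (I := 𝓘(ℝ, E)) (x := p₀)).contMDiffAt
      ((chartAt E p₀).open_target.mem_nhds ((chartAt E p₀).map_source hp))
  rw [← (chartAt E p₀).left_inv hp] at hr
  exact (hr.comp _ hs).contDiffAt

theorem fderiv_comp_chart_symm {r : M → ℝ} (p₀ : M) {p : M} (hp : p ∈ (chartAt E p₀).source)
    (hr : MDifferentiableAt 𝓘(ℝ, E) 𝓘(ℝ, ℝ) r p) (v : TangentSpace 𝓘(ℝ, E) p) :
    fderiv ℝ (r ∘ (chartAt E p₀).symm) (chartAt E p₀ p)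
      (mfderiv 𝓘(ℝ, E) 𝓘(ℝ, E) (chartAt E p₀) p v)
      = (mfderiv 𝓘(ℝ, E) 𝓘(ℝ, ℝ) r p v : ℝ) := by
  have hes : (chartAt E p₀).symm (chartAt E p₀ p) = p := (chartAt E p₀).left_inv hp
  rw [← hes] at hr
  have h4 : fderiv ℝ (r ∘ (chartAt E p₀).symm) (chartAt E p₀ p)
      = (mfderiv 𝓘(ℝ, E) 𝓘(ℝ, ℝ) r ((chartAt E p₀).symm (chartAt E p₀ p)) : E →L[ℝ] ℝ).comp
        (mfderiv 𝓘(ℝ, E) 𝓘(ℝ, E) (chartAt E p₀).symm (chartAt E p₀ p) : E →L[ℝ] E) := by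
    rw [← mfderiv_eq_fderiv]
    exact mfderiv_comp _ hr
      ((mdifferentiable_chartAt p₀).mdifferentiableAt_symm ((chartAt E p₀).map_source hp))
  have h5 : ∀ q : M, q = p → ∀ u u' : E, u = u' →
      (mfderiv 𝓘(ℝ, E) 𝓘(ℝ, ℝ) r q : E →L[ℝ] ℝ) u
        = (mfderiv 𝓘(ℝ, E) 𝓘(ℝ, ℝ) r p : E →L[ℝ] ℝ) u' := by
    rintro q rfl u _ rfl; rfl
  rw [h4]
  exact h5 _ hes _ _ (mfderiv_symm_mfderiv_chart p₀ hp v)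

end Charts

/-! ### The orthogonal projection onto `O` and the form `g_O` -/

section Projection

set_option maxSynthPendingDepth 3

variable {E : Type*} [NormedAddCommGroup E] [NormedSpace ℝ E]
  {M : Type*} [TopologicalSpace M] [ChartedSpace E M]
  [IsManifold 𝓘(ℝ, E) ∞ M]

theorem inner_self_nonneg (g : RiemMetric E M) (p : M) (v : TangentSpace 𝓘(ℝ, E) p) :
    0 ≤ g.inner p v v := by
  rcases eq_or_ne v 0 with rfl | h
  · simp
  · exact (g.pos p v h).le

variable [FiniteDimensional ℝ E]

theorem orthProj_mem (g : RiemMetric E M) (p : M)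
    (S : Submodule ℝ (TangentSpace 𝓘(ℝ, E) p)) (v : TangentSpace 𝓘(ℝ, E) p) :
    orthProj g p S v ∈ S :=
  Submodule.projection_apply_mem (isCompl_orthogonal g p S) v

theorem orthProj_of_mem (g : RiemMetric E M) (p : M)
    (S : Submodule ℝ (TangentSpace 𝓘(ℝ, E) p)) {v : TangentSpace 𝓘(ℝ, E) p} (hv : v ∈ S) :
    orthProj g p S v = v :=
  Submodule.projection_apply_of_mem_left (isCompl_orthogonal g p S) hv

theorem inner_orthProj (g : RiemMetric E M) (p : M)
    (S : Submodule ℝ (TangentSpace 𝓘(ℝ, E) p)) {s : TangentSpace 𝓘(ℝ, E) p} (hs : s ∈ S)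
    (v : TangentSpace 𝓘(ℝ, E) p) : g.inner p s (orthProj g p S v) = g.inner p s v := by
  have h1 : v - orthProj g p S v ∈ (innerForm g p).orthogonal S := by
    rw [← Submodule.projection_apply_eq_zero_iff (isCompl_orthogonal g p S)]
    change orthProj g p S (v - orthProj g p S v) = 0
    rw [map_sub, orthProj_of_mem g p S (orthProj_mem g p S v), sub_self]
  have h2 : g.inner p s (v - orthProj g p S v) = 0 := h1 s hs
  rw [map_sub, sub_eq_zero] at h2
  exact h2.symm

/-- The degenerate metric `g_O`. -/
def projForm (g : RiemMetric E M) (O : ∀ q : M, Submodule ℝ (TangentSpace 𝓘(ℝ, E) q)) (p : M) :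
    TangentSpace 𝓘(ℝ, E) p →L[ℝ] TangentSpace 𝓘(ℝ, E) p →L[ℝ] ℝ :=
  let P : E →L[ℝ] E := orthProj g p (O p)
  let B : E →L[ℝ] E →L[ℝ] ℝ := g.inner p
  (B.bilinearComp P P : E →L[ℝ] E →L[ℝ] ℝ)

theorem projForm_apply (g : RiemMetric E M)
    (O : ∀ q : M, Submodule ℝ (TangentSpace 𝓘(ℝ, E) q)) (p : M)
    (v w : TangentSpace 𝓘(ℝ, E) p) :
    projForm g O p v w = g.inner p (orthProj g p (O p) v) (orthProj g p (O p) w) := rfl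

theorem inner_eq_add_orthProj (g : RiemMetric E M) (p : M)
    (S : Submodule ℝ (TangentSpace 𝓘(ℝ, E) p)) (v w : TangentSpace 𝓘(ℝ, E) p) :
    g.inner p v w = g.inner p (orthProj g p S v) (orthProj g p S w)
      + g.inner p (v - orthProj g p S v) (w - orthProj g p S w) := by
  have h1 := inner_orthProj g p S (orthProj_mem g p S v) w
  have h2 := inner_orthProj g p S (orthProj_mem g p S w) v
  rw [g.symm p (orthProj g p S w), g.symm p (orthProj g p S w)] at h2
  simp only [map_sub, sub_apply]
  linarith

theorem projForm_self_le (g : RiemMetric E M)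
    (O : ∀ q : M, Submodule ℝ (TangentSpace 𝓘(ℝ, E) q)) (p : M)
    (v : TangentSpace 𝓘(ℝ, E) p) : projForm g O p v v ≤ g.inner p v v := by
  rw [inner_eq_add_orthProj g p (O p) v v, projForm_apply]
  linarith [inner_self_nonneg g p (v - orthProj g p (O p) v)]

/-- Eliminating `g_{O^⊥} = g - g_O` leaves a perturbation of `g` by a scalar multiple of `g_O`, the
shape studied in coordinates. -/
theorem partialConformalChange_apply (g : RiemMetric E M)
    (O : ∀ q : M, Submodule ℝ (TangentSpace 𝓘(ℝ, E) q)) (φ : M → ℝ) (p : M)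
    (v w : TangentSpace 𝓘(ℝ, E) p) :
    partialConformalChange g O φ p v w
      = g.inner p v w + (φ p ^ 2 - 1) * projForm g O p v w := by
  have h : partialConformalChange g O φ p v w
      = φ p ^ 2 * g.inner p (orthProj g p (O p) v) (orthProj g p (O p) w)
        + g.inner p (v - orthProj g p (O p) v) (w - orthProj g p (O p) w) := rfl
  rw [h, inner_eq_add_orthProj g p (O p) v w, projForm_apply]
  ring

theorem metricInChart_partialConformalChange (g : RiemMetric E M)
    (O : ∀ q : M, Submodule ℝ (TangentSpace 𝓘(ℝ, E) q)) (φ : M → ℝ)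
    (e : OpenPartialHomeomorph M E) :
    metricInChart (partialConformalChange g O φ) e
      = fun y ↦ metricInChart g.inner e y
        + (φ (e.symm y) ^ 2 - 1) • metricInChart (projForm g O) e y := by
  funext y
  ext a b
  exact partialConformalChange_apply g O φ (e.symm y) _ _

/-! ### Gram matrices -/

section Gram

variable {V : Type*} [AddCommGroup V] [Module ℝ V] {k : ℕ}

/-- The Gram matrix of a family of vectors. -/
def gramMatrix (B : V → V → ℝ) (F : Fin k → V) : Matrix (Fin k) (Fin k) ℝ :=
  Matrix.of fun i j ↦ B (F i) (F j)

/-- A kernel vector `c` of the Gram matrix would make the nonzero vector `∑ c_i F_i` isotropic. -/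
theorem gramMatrix_det_ne_zero (B : V →ₗ[ℝ] V →ₗ[ℝ] ℝ) (hpos : ∀ v, v ≠ 0 → 0 < B v v)
    {F : Fin k → V} (hF : LinearIndependent ℝ F) :
    (gramMatrix (fun v w ↦ B v w) F).det ≠ 0 := by
  intro h0
  obtain ⟨c, hc, hMc⟩ := Matrix.exists_mulVec_eq_zero_iff.2 h0
  have hv : ∑ i, c i • F i ≠ 0 := fun h ↦
    hc (funext fun i ↦ Fintype.linearIndependent_iff.1 hF c h i)
  have h1 := hpos _ hv
  have h2 : B (∑ i, c i • F i) (∑ i, c i • F i) = 0 := by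
    have h4 : ∀ u, B (∑ i, c i • F i) u = ∑ i, c i * B (F i) u := fun u ↦ by
      simp [map_sum, LinearMap.sum_apply]
    rw [h4]
    refine Finset.sum_eq_zero fun i _ ↦ ?_
    have h3 := congrFun hMc i
    simp only [Matrix.mulVec, dotProduct, gramMatrix, Matrix.of_apply, Pi.zero_apply] at h3
    simp only [map_smul, map_sum, smul_eq_mul]
    rw [show ∑ x, c x * B (F i) (F x) = 0 by
      rw [← h3]; exact Finset.sum_congr rfl fun _ _ ↦ mul_comm _ _, mul_zero]
  exact h1.ne' h2

/-- Here `w'` plays the orthogonal projection of `w` onto the span: its coefficients solve the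
linear system of the Gram matrix. This expresses `g_O` through a frame, without mentioning the
projection. -/
theorem apply_eq_gramMatrix_inv (B : V →ₗ[ℝ] V →ₗ[ℝ] ℝ) (hpos : ∀ v, v ≠ 0 → 0 < B v v)
    {F : Fin k → V} (hF : LinearIndependent ℝ F) {w w' : V}
    (hw' : w' ∈ Submodule.span ℝ (Set.range F)) (hww' : ∀ i, B (F i) w' = B (F i) w) (v : V) :
    B v w' = ∑ i, ∑ j, B v (F i) * (gramMatrix (fun v w ↦ B v w) F)⁻¹ i j * B (F j) w := by
  obtain ⟨c, rfl⟩ := (Submodule.mem_span_range_iff_exists_fun ℝ).1 hw'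
  have h1 : (gramMatrix (fun v w ↦ B v w) F).mulVec c = fun j ↦ B (F j) w := by
    funext j
    rw [← hww' j]
    simp [Matrix.mulVec, dotProduct, gramMatrix, map_sum, mul_comm]
  have h2 : c = (gramMatrix (fun v w ↦ B v w) F)⁻¹.mulVec fun j ↦ B (F j) w := by
    rw [← h1, Matrix.mulVec_mulVec, Matrix.nonsing_inv_mul _
      (isUnit_iff_ne_zero.2 (gramMatrix_det_ne_zero B hpos hF)), Matrix.one_mulVec]
  rw [map_sum]
  refine Finset.sum_congr rfl fun i _ ↦ ?_
  rw [map_smul, smul_eq_mul, mul_comm]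
  conv_lhs => rw [h2]
  simp [Matrix.mulVec, dotProduct, Finset.mul_sum, mul_assoc]

end Gram

end Projection

/-! ### Smoothness of `g` and `g_O` in a chart -/

section Smoothness

set_option maxSynthPendingDepth 3

variable {E : Type*} [NormedAddCommGroup E] [NormedSpace ℝ E]

theorem contDiffAt_matrix_det {k : ℕ} {n : ℕ∞ω} {A : E → Matrix (Fin k) (Fin k) ℝ} {y : E}
    (hA : ∀ i j, ContDiffAt ℝ n (fun z ↦ A z i j) y) : ContDiffAt ℝ n (fun z ↦ (A z).det) y := by
  simp only [Matrix.det_apply]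
  refine ContDiffAt.sum fun σ _ ↦ ?_
  exact (contDiffAt_prod fun i _ ↦ hA _ _).const_smul _

/-- Cramer's rule: the entries of the inverse are quotients of determinants. -/
theorem contDiffAt_matrix_inv {k : ℕ} {n : ℕ∞ω} {A : E → Matrix (Fin k) (Fin k) ℝ} {y : E}
    (hA : ∀ i j, ContDiffAt ℝ n (fun z ↦ A z i j) y) (h0 : (A y).det ≠ 0) (i j : Fin k) :
    ContDiffAt ℝ n (fun z ↦ (A z)⁻¹ i j) y := by
  simp only [Matrix.inv_def, Matrix.smul_apply, Matrix.adjugate_apply, smul_eq_mul,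
    Ring.inverse_eq_inv']
  refine ((contDiffAt_matrix_det hA).inv h0).mul (contDiffAt_matrix_det fun a b ↦ ?_)
  simp only [Matrix.updateRow_apply]
  split_ifs
  · exact contDiffAt_const
  · exact hA a b

theorem contDiffAt_clm_of_apply [FiniteDimensional ℝ E] {F : Type*} [NormedAddCommGroup F]
    [NormedSpace ℝ F] {n : ℕ∞ω} {f : E → E →L[ℝ] F} {y : E}
    (hf : ∀ a, ContDiffAt ℝ n (fun z ↦ f z a) y) : ContDiffAt ℝ n f y := by
  let d := Module.finrank ℝ E
  have hd : d = Module.finrank ℝ (Fin d → ℝ) := (Module.finrank_fin_fun ℝ).symm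
  let e₁ := ContinuousLinearEquiv.ofFinrankEq hd
  let e₂ := (e₁.arrowCongr (1 : F ≃L[ℝ] F)).trans (ContinuousLinearEquiv.piRing (Fin d))
  rw [← Function.id_comp f, ← e₂.symm_comp_self]
  exact e₂.symm.contDiff.contDiffAt.comp y (contDiffAt_pi.2 fun i ↦ hf _)

variable {M : Type*} [TopologicalSpace M] [ChartedSpace E M] [IsManifold 𝓘(ℝ, E) ∞ M]

theorem contDiffAt_inner (g : RiemMetric E M) {b : E → M} {y : E}
    {v w : ∀ z : E, TangentSpace 𝓘(ℝ, E) (b z)}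
    (hv : ContMDiffAt 𝓘(ℝ, E) 𝓘(ℝ, E).tangent ∞ (fun z ↦ (⟨b z, v z⟩ : TangentBundle 𝓘(ℝ, E) M)) y)
    (hw : ContMDiffAt 𝓘(ℝ, E) 𝓘(ℝ, E).tangent ∞
      (fun z ↦ (⟨b z, w z⟩ : TangentBundle 𝓘(ℝ, E) M)) y) :
    ContDiffAt ℝ ∞ (fun z ↦ g.inner (b z) (v z) (w z)) y := by
  have hb : ContMDiffAt 𝓘(ℝ, E) 𝓘(ℝ, E) ∞ b y := by
    have h := hv
    simp only [Bundle.contMDiffAt_totalSpace] at h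
    exact h.1
  have : ContMDiffAt 𝓘(ℝ, E) (𝓘(ℝ, E).prod 𝓘(ℝ)) ∞
      (fun z ↦ Bundle.TotalSpace.mk' ℝ (E := Bundle.Trivial M ℝ) (b z)
        (g.inner (b z) (v z) (w z))) y := by
    apply ContMDiffAt.clm_bundle_apply₂ (F₁ := E) (F₂ := E)
    · exact ContMDiffAt.comp y g.contMDiff.contMDiffAt hb
    · exact hv
    · exact hw
  simp only [Bundle.contMDiffAt_totalSpace] at this
  exact this.2.contDiffAt

theorem contMDiffAt_chart_symm_section (p₀ : M) {y : E} (hy : y ∈ (chartAt E p₀).target) (a : E) :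
    ContMDiffAt 𝓘(ℝ, E) 𝓘(ℝ, E).tangent ∞
      (fun z ↦ (⟨(chartAt E p₀).symm z, mfderiv 𝓘(ℝ, E) 𝓘(ℝ, E) (chartAt E p₀).symm z a⟩ :
        TangentBundle 𝓘(ℝ, E) M)) y := by
  have hs : ContMDiffAt 𝓘(ℝ, E) 𝓘(ℝ, E) ∞ (chartAt E p₀).symm y :=
    (contMDiffOn_chart_symm (I := 𝓘(ℝ, E)) (x := p₀)).contMDiffAt
      ((chartAt E p₀).open_target.mem_nhds hy)
  have : IsManifold 𝓘(ℝ, E) 1 M := .of_le (n := ∞) (by simp)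
  have hϕ := hs.mfderiv_const (m := ∞) (by simp)
  have hv : ContMDiffAt 𝓘(ℝ, E) 𝓘(ℝ, E).tangent ∞
      (fun z ↦ (⟨z, a⟩ : TangentBundle 𝓘(ℝ, E) E)) y :=
    contMDiffAt_vectorSpace_iff_contDiffAt.2 contDiffAt_const
  exact hϕ.clm_apply_of_inCoordinates (b₁ := id) hv hs

variable [FiniteDimensional ℝ E]

theorem contDiffAt_metricInChart (g : RiemMetric E M) (p₀ : M) {y : E}
    (hy : y ∈ (chartAt E p₀).target) :
    ContDiffAt ℝ ∞ (metricInChart g.inner (chartAt E p₀)) y := by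
  refine contDiffAt_clm_of_apply fun a ↦ contDiffAt_clm_of_apply fun b ↦ ?_
  exact contDiffAt_inner g (contMDiffAt_chart_symm_section p₀ hy a)
    (contMDiffAt_chart_symm_section p₀ hy b)

/-- The projection is defined pointwise, with no smoothness built in. A local frame of `O` supplies
it: `g_O(a, b)` is a sum of products of inner products with the frame and entries of the inverse
Gram matrix. -/
theorem contDiffAt_metricInChart_projForm (g : RiemMetric E M)
    {O : ∀ q : M, Submodule ℝ (TangentSpace 𝓘(ℝ, E) q)} {U : Set M}
    (hO : IsSmoothDistributionOn O U) (p₀ : M) {y : E} (hy : y ∈ (chartAt E p₀).target)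
    (hyU : (chartAt E p₀).symm y ∈ U) :
    ContDiffAt ℝ ∞ (metricInChart (projForm g O) (chartAt E p₀)) y := by
  obtain ⟨N, hN, hyN, k, F, hF, hFO⟩ := hO _ hyU
  have hs : ContMDiffAt 𝓘(ℝ, E) 𝓘(ℝ, E) ∞ (chartAt E p₀).symm y :=
    (contMDiffOn_chart_symm (I := 𝓘(ℝ, E)) (x := p₀)).contMDiffAt
      ((chartAt E p₀).open_target.mem_nhds hy)
  have hFs : ∀ i, ContMDiffAt 𝓘(ℝ, E) 𝓘(ℝ, E).tangent ∞
      (fun z ↦ (⟨(chartAt E p₀).symm z, F i ((chartAt E p₀).symm z)⟩ :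
        TangentBundle 𝓘(ℝ, E) M)) y := fun i ↦
    ((hF i).contMDiffAt (hN.mem_nhds hyN)).comp y hs
  have hNy : ∀ᶠ z in nhds y, (chartAt E p₀).symm z ∈ N :=
    ((chartAt E p₀).continuousAt_symm hy).eventually (hN.mem_nhds hyN)
  refine contDiffAt_clm_of_apply fun a ↦ contDiffAt_clm_of_apply fun b ↦ ?_
  have hformula : (fun z ↦ metricInChart (projForm g O) (chartAt E p₀) z a b) =ᶠ[nhds y]
      fun z ↦ ∑ i, ∑ j, g.inner ((chartAt E p₀).symm z)
          (mfderiv 𝓘(ℝ, E) 𝓘(ℝ, E) (chartAt E p₀).symm z a) (F i ((chartAt E p₀).symm z))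
        * (gramMatrix (fun v w ↦ g.inner ((chartAt E p₀).symm z) v w)
            fun i ↦ F i ((chartAt E p₀).symm z))⁻¹ i j
        * g.inner ((chartAt E p₀).symm z) (F j ((chartAt E p₀).symm z))
          (mfderiv 𝓘(ℝ, E) 𝓘(ℝ, E) (chartAt E p₀).symm z b) := by
    filter_upwards [hNy] with z hz
    obtain ⟨hli, hspan⟩ := hFO _ hz
    set q := (chartAt E p₀).symm z
    have hmem : ∀ i, F i q ∈ O q := fun i ↦ hspan ▸ Submodule.subset_span ⟨i, rfl⟩
    -- Self-adjointness and idempotence of the projection `P` turn `g(Pa, Pb)` into `g(a, Pb)`.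
    rw [metricInChart_apply, projForm_apply,
      g.symm, inner_orthProj g q (O q) (orthProj_mem g q (O q) _), g.symm]
    exact apply_eq_gramMatrix_inv (innerForm g q) (g.pos q) hli
      (by rw [hspan]; exact orthProj_mem g q (O q) _) (fun i ↦ inner_orthProj g q (O q) (hmem i) _) _
  refine ContDiffAt.congr_of_eventuallyEq ?_ hformula
  refine ContDiffAt.sum fun i _ ↦ ContDiffAt.sum fun j _ ↦ ?_
  refine ((contDiffAt_inner g (contMDiffAt_chart_symm_section p₀ hy a) (hFs i)).mul ?_).mul
    (contDiffAt_inner g (hFs j) (contMDiffAt_chart_symm_section p₀ hy b))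
  exact contDiffAt_matrix_inv (fun i j ↦ contDiffAt_inner g (hFs i) (hFs j))
    (gramMatrix_det_ne_zero (innerForm g _) (g.pos _) (hFO _ hyN).1) i j

end Smoothness

/-! ### Distance functions, the local curvature bound and compactness -/

section DistanceFunction

set_option maxSynthPendingDepth 3

variable {E : Type*} [NormedAddCommGroup E] [NormedSpace ℝ E]
  {M : Type*} [TopologicalSpace M] [ChartedSpace E M]
  [IsManifold 𝓘(ℝ, E) ∞ M]

theorem metricInChart_inner_symm (g : RiemMetric E M) (e : OpenPartialHomeomorph M E)
    (y v w : E) : metricInChart g.inner e y v w = metricInChart g.inner e y w v := by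
  rw [metricInChart_apply, metricInChart_apply]
  exact g.symm _ _ _

theorem metricInChart_inner_pos (g : RiemMetric E M) (p₀ : M) {y : E}
    (hy : y ∈ (chartAt E p₀).target) (v : E) (hv : v ≠ 0) :
    0 < metricInChart g.inner (chartAt E p₀) y v v := by
  rw [metricInChart_apply]
  exact g.pos _ _ fun h0 ↦ hv (eq_zero_of_mfderiv_chart_symm p₀ hy h0)

variable [FiniteDimensional ℝ E]

theorem inner_gradient (g : RiemMetric E M) (r : M → ℝ) (p : M) (v : TangentSpace 𝓘(ℝ, E) p) :
    g.inner p (gradient g r p) v = (mfderiv 𝓘(ℝ, E) 𝓘(ℝ, ℝ) r p v : ℝ) := by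
  have hi : (g.inner p : E →L[ℝ] E →L[ℝ] ℝ).IsInvertible := isInvertible_of_posDef (E := E) (g.pos p)
  have h := hi.self_apply_inverse (mfderiv 𝓘(ℝ, E) 𝓘(ℝ, ℝ) r p : E →L[ℝ] ℝ)
  exact congrArg (fun L : E →L[ℝ] ℝ ↦ L v) h

theorem IsDistanceFunctionOn.dirDeriv_comp {g : RiemMetric E M} {U : Set M} (hU : IsOpen U)
    {r : M → ℝ} (hr : IsDistanceFunctionOn g r U) {h : ℝ → ℝ} (hh : Differentiable ℝ h) {p : M}
    (hp : p ∈ U) : dirDeriv (gradient g r) (h ∘ r) p = deriv h (r p) := by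
  have hrd : MDifferentiableAt 𝓘(ℝ, E) 𝓘(ℝ, ℝ) r p :=
    (hr.1.contMDiffAt (hU.mem_nhds hp)).mdifferentiableAt (by simp)
  have h1 : (mfderiv 𝓘(ℝ, E) 𝓘(ℝ, ℝ) r p (gradient g r p) : ℝ) = 1 :=
    (inner_gradient g r p _).symm.trans (hr.2 p hp)
  have h2 : dirDeriv (gradient g r) (h ∘ r) p
      = fderiv ℝ h (r p) (mfderiv 𝓘(ℝ, E) 𝓘(ℝ, ℝ) r p (gradient g r p) : ℝ) := by
    rw [dirDeriv, mfderiv_comp p (hh (r p)).mdifferentiableAt hrd, mfderiv_eq_fderiv]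
    rfl
  have h3 : ∀ a : ℝ, a = 1 → fderiv ℝ h (r p) a = deriv h (r p) := by
    rintro _ rfl
    exact fderiv_apply_one_eq_deriv
  exact h2.trans (h3 _ h1)

theorem IsDistanceFunctionOn.dirDeriv_dirDeriv_comp {g : RiemMetric E M} {U : Set M}
    (hU : IsOpen U) {r : M → ℝ} (hr : IsDistanceFunctionOn g r U) {f : ℝ → ℝ}
    (hf : ContDiff ℝ 2 f) {p : M} (hp : p ∈ U) :
    dirDeriv (gradient g r) (dirDeriv (gradient g r) (f ∘ r)) p = deriv (deriv f) (r p) := by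
  have hev : dirDeriv (gradient g r) (f ∘ r) =ᶠ[nhds p] deriv f ∘ r := by
    filter_upwards [hU.mem_nhds hp] with q hq
    exact hr.dirDeriv_comp hU (hf.differentiable (by norm_num)) hq
  have hf' : Differentiable ℝ (deriv f) := (hf.iterate_deriv' 1 1).differentiable (by norm_num)
  rw [← hr.dirDeriv_comp hU hf' hp, dirDeriv, hev.mfderiv_eq]
  rfl

/-- Finitely many of the local neighbourhoods cover `K`, and monotonicity allows the largest of
their constants. -/
theorem exists_forall_mem_of_isCompact {K : Set M} (hK : IsCompact K) {Q : ℝ → M → Prop}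
    (hmono : ∀ C C' p, C ≤ C' → Q C p → Q C' p)
    (hloc : ∀ p ∈ K, ∃ C, ∀ᶠ q in nhds p, Q C q) : ∃ C, ∀ p ∈ K, Q C p := by
  refine hK.induction_on (p := fun s ↦ ∃ C, ∀ p ∈ s, Q C p) ⟨0, by simp⟩ ?_ ?_ ?_
  · rintro s t hst ⟨C, hC⟩
    exact ⟨C, fun p hp ↦ hC p (hst hp)⟩
  · rintro s t ⟨C, hC⟩ ⟨C', hC'⟩
    refine ⟨max C C', fun p hp ↦ ?_⟩
    rcases hp with hp | hp
    · exact hmono _ _ _ (le_max_left _ _) (hC p hp)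
    · exact hmono _ _ _ (le_max_right _ _) (hC' p hp)
  · intro p hp
    obtain ⟨C, hC⟩ := hloc p hp
    exact ⟨_, mem_nhdsWithin_of_mem_nhds hC, C, fun q hq ↦ hq⟩

/-- The curvature estimate at the point `p` with the constant `C`. -/
def CurvatureBoundAt (g : RiemMetric E M) (r : M → ℝ)
    (O : ∀ p : M, Submodule ℝ (TangentSpace 𝓘(ℝ, E) p)) (C : ℝ) (p : M) : Prop :=
  ∀ f : ℝ → ℝ, ContDiff ℝ ∞ f → (∀ t, 0 < f t) →
    (∀ V ∈ O p, g.inner p V (gradient g r p) = 0) →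
    max |1 - f (r p)| |deriv f (r p)| ≤ 1 / 2 → ∀ V ∈ O p,
      |curvatureTensor (partialConformalChange g O (f ∘ r)) p V (gradient g r p)
          (gradient g r p) V
        - (curvatureTensor g.inner p V (gradient g r p) (gradient g r p) V
          - deriv (deriv f) (r p) * g.inner p V V)|
      ≤ (C + |deriv (deriv f) (r p)|) * max |1 - f (r p)| |deriv f (r p)| * g.inner p V V

theorem CurvatureBoundAt.mono {g : RiemMetric E M} {r : M → ℝ}
    {O : ∀ p : M, Submodule ℝ (TangentSpace 𝓘(ℝ, E) p)} {C C' : ℝ} {p : M} (hC : C ≤ C')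
    (h : CurvatureBoundAt g r O C p) : CurvatureBoundAt g r O C' p := by
  intro f hf hfp hperp hδ V hV
  refine (h f hf hfp hperp hδ V hV).trans ?_
  have h0 := inner_self_nonneg g p V
  have h1 : 0 ≤ max |1 - f (r p)| |deriv f (r p)| := (abs_nonneg _).trans (le_max_left _ _)
  gcongr

theorem metricInChart_projForm_symm (g : RiemMetric E M)
    (O : ∀ q : M, Submodule ℝ (TangentSpace 𝓘(ℝ, E) q)) (e : OpenPartialHomeomorph M E)
    (y v w : E) :
    metricInChart (projForm g O) e y v w = metricInChart (projForm g O) e y w v := by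
  rw [metricInChart_apply, metricInChart_apply, projForm_apply, projForm_apply]
  exact g.symm _ _ _

theorem metricInChart_projForm_nonneg (g : RiemMetric E M)
    (O : ∀ q : M, Submodule ℝ (TangentSpace 𝓘(ℝ, E) q)) (e : OpenPartialHomeomorph M E)
    (y v : E) : 0 ≤ metricInChart (projForm g O) e y v v := by
  rw [metricInChart_apply, projForm_apply]
  exact inner_self_nonneg g _ _

theorem metricInChart_projForm_le (g : RiemMetric E M)
    (O : ∀ q : M, Submodule ℝ (TangentSpace 𝓘(ℝ, E) q)) (e : OpenPartialHomeomorph M E)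
    (y v : E) : metricInChart (projForm g O) e y v v ≤ metricInChart g.inner e y v v := by
  rw [metricInChart_apply, metricInChart_apply]
  exact projForm_self_le g O _ _

/-- The curvature estimate near a point. -/
theorem exists_local_curvature_bound (g : RiemMetric E M) {U : Set M} (hU : IsOpen U)
    {r : M → ℝ} (hr : IsDistanceFunctionOn g r U)
    {O : ∀ p : M, Submodule ℝ (TangentSpace 𝓘(ℝ, E) p)} (hO : IsSmoothDistributionOn O U)
    {p₀ : M} (hp₀ : p₀ ∈ U) :
    ∃ C : ℝ, ∀ᶠ p in nhds p₀, CurvatureBoundAt g r O C p := by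
  let e := chartAt E p₀
  let G := metricInChart g.inner e
  let H := metricInChart (projForm g O) e
  let ρ : E → ℝ := r ∘ e.symm
  have hp₀s : p₀ ∈ e.source := mem_chart_source E p₀
  have hreg : ∀ q ∈ e.source, q ∈ U → ContDiffAt ℝ 3 G (e q) ∧ ContDiffAt ℝ 3 H (e q) ∧
      ContDiffAt ℝ 3 ρ (e q) := by
    intro q hq hqU
    have hqt : e q ∈ e.target := e.map_source hq
    have hqU' : e.symm (e q) ∈ U := by rwa [e.left_inv hq]
    exact ⟨(contDiffAt_metricInChart g p₀ hqt).of_le (by norm_cast),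
      (contDiffAt_metricInChart_projForm g hO p₀ hqt hqU').of_le (by norm_cast),
      (contDiffAt_comp_chart_symm p₀ hq (hr.1.contMDiffAt (hU.mem_nhds hqU))).of_le
        (by norm_cast)⟩
  have hGs : ∀ z v w, G z v w = G z w v := metricInChart_inner_symm g e
  have hHs : ∀ z v w, H z v w = H z w v := metricInChart_projForm_symm g O e
  have hGp : ∀ z ∈ e.target, ∀ v, v ≠ 0 → 0 < G z v v := fun z hz ↦
    metricInChart_inner_pos g p₀ hz
  have hH0 := metricInChart_projForm_nonneg g O e
  have hHG := metricInChart_projForm_le g O e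
  obtain ⟨h1, h2, h3⟩ := hreg p₀ hp₀s hp₀
  obtain ⟨C, hC⟩ := exists_coordCurvature_bound h1 h2 h3 (.of_forall hGs) (.of_forall hHs)
    (Filter.Eventually.mono (e.open_target.mem_nhds (e.map_source hp₀s)) hGp)
    (.of_forall hH0) (.of_forall hHG)
  refine ⟨C, ?_⟩
  filter_upwards [(e.continuousAt hp₀s).eventually hC, e.open_source.mem_nhds hp₀s,
    hU.mem_nhds hp₀] with p hCp hps hpU f hf hfpos hperp hδ V hV
  obtain ⟨k1, k2, k3⟩ := hreg p hps hpU
  have hρp : ρ (e p) = r p := congrArg r (e.left_inv hps)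
  have hf2 : ContDiff ℝ 2 f := hf.of_le (by norm_cast)
  have hfp : 0 < f (r p) := hfpos _
  have hrd : MDifferentiableAt 𝓘(ℝ, E) 𝓘(ℝ, ℝ) r p :=
    (hr.1.contMDiffAt (hU.mem_nhds hpU)).mdifferentiableAt (by simp)
  -- In the chart `dρ` is `g(X, ·)`. This gives `dρ(V) = 0` from orthogonality and `dρ(X) = 1` from
  -- the unit length of `X`.
  have hdρ : ∀ v : TangentSpace 𝓘(ℝ, E) p,
      fderiv ℝ ρ (e p) (mfderiv 𝓘(ℝ, E) 𝓘(ℝ, E) e p v) = g.inner p (gradient g r p) v := fun v ↦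
    (fderiv_comp_chart_symm p₀ hps hrd v).trans (inner_gradient g r p v).symm
  have hXX := hr.2 p hpU
  have hVX : g.inner p (gradient g r p) V = 0 := (g.symm _ _ _).trans (hperp V hV)
  have hHV : projForm g O p V V = g.inner p V V := by
    rw [projForm_apply, orthProj_of_mem g p (O p) hV]
  have hGV : G (e p) (mfderiv 𝓘(ℝ, E) 𝓘(ℝ, E) e p V) (mfderiv 𝓘(ℝ, E) 𝓘(ℝ, E) e p V)
      = g.inner p V V := metricInChart_mfderiv_chart g.inner p₀ hps V V
  have main := hCp f hf2 (hρp.symm ▸ hδ) (mfderiv 𝓘(ℝ, E) 𝓘(ℝ, E) e p V)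
    (mfderiv 𝓘(ℝ, E) 𝓘(ℝ, E) e p (gradient g r p)) ((hdρ V).trans hVX)
    ((hdρ (gradient g r p)).trans hXX)
    ((metricInChart_mfderiv_chart g.inner p₀ hps _ _).trans hXX)
    ((metricInChart_mfderiv_chart (projForm g O) p₀ hps V V).trans (hHV.trans hGV.symm))
  have hGtd : ContDiffAt ℝ 2 (fun z ↦ G z + (f (ρ z) ^ 2 - 1) • H z) (e p) :=
    (k1.of_le (by norm_num)).add ((((hf2.contDiffAt.comp (e p) (k3.of_le (by norm_num))).pow
      2).sub contDiffAt_const).smul (k2.of_le (by norm_num)))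
  have hGts : ∀ z v w, (G z + (f (ρ z) ^ 2 - 1) • H z) v w
      = (G z + (f (ρ z) ^ 2 - 1) • H z) w v := fun z v w ↦ by
    simp only [add_apply, smul_apply]
    rw [hGs z v w, hHs z v w]
  have hGtp : ∀ v, v ≠ 0 → 0 < (G (e p) + (f (ρ (e p)) ^ 2 - 1) • H (e p)) v v :=
    add_smul_posDef (hGp _ (e.map_source hps)) (hH0 _) (hHG _) (by rw [hρp]; nlinarith)
  -- Both curvature tensors, defined at `p` by the chart at `p`, are moved to the fixed chart at
  -- `p₀`, where the coordinate estimate holds.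
  have c1 := curvatureTensor_eq_chart (partialConformalChange g O (f ∘ r)) p₀ hps
  rw [metricInChart_partialConformalChange g O (f ∘ r)] at c1
  have c1 := c1 hGtd (.of_forall hGts) hGtp V (gradient g r p) (gradient g r p) V
  have c2 := curvatureTensor_eq_chart g.inner p₀ hps (k1.of_le (by norm_num))
    (.of_forall hGs) (hGp _ (e.map_source hps)) V (gradient g r p) (gradient g r p) V
  rw [c1, c2, ← hρp]
  rw [hGV] at main
  exact main

end DistanceFunction
end PartialConformal
end

theorem mainTheorem5 {E : Type*} [NormedAddCommGroup E] [NormedSpace ℝ E] [FiniteDimensional ℝ E]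
    {M : Type*} [TopologicalSpace M] [ChartedSpace E M] [IsManifold 𝓘(ℝ, E) ∞ M]
    (g : PartialConformal.RiemMetric E M)
    (U : Set M) (hU : IsOpen U)
    (r : M → ℝ) (hr : PartialConformal.IsDistanceFunctionOn g r U)
    (X : ∀ p : M, TangentSpace 𝓘(ℝ, E) p) (hX : ∀ p, X p = PartialConformal.gradient g r p)
    (O : ∀ p : M, Submodule ℝ (TangentSpace 𝓘(ℝ, E) p))
    (hO : PartialConformal.IsSmoothDistributionOn O U)
    (S : Set M) (hSU : S ⊆ U) (hOX : ∀ p ∈ S, ∀ V ∈ O p, g.inner p V (X p) = 0) :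
    (∀ f : ℝ → ℝ, ContDiff ℝ ∞ f → ∀ p ∈ U,
      PartialConformal.dirDeriv X (PartialConformal.dirDeriv X (f ∘ r)) p
        = deriv (deriv f) (r p)) ∧
    ∀ K : Set M, IsCompact K → K ⊆ U → ∃ C : ℝ, ∀ f : ℝ → ℝ, ContDiff ℝ ∞ f → (∀ t, 0 < f t) →
      ∀ p ∈ K ∩ S, max |1 - f (r p)| |deriv f (r p)| ≤ 1 / 2 → ∀ V ∈ O p,
        |PartialConformal.curvatureTensor
            (PartialConformal.partialConformalChange g O (f ∘ r)) p V (X p) (X p) V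
          - (PartialConformal.curvatureTensor g.inner p V (X p) (X p) V
            - deriv (deriv f) (r p) * g.inner p V V * g.inner p (X p) (X p))|
        ≤ (C + |deriv (deriv f) (r p)|) * max |1 - f (r p)| |deriv f (r p)|
            * g.inner p V V * g.inner p (X p) (X p) := by
  obtain rfl : X = PartialConformal.gradient g r := funext hX
  refine ⟨fun f hf p hp ↦ hr.dirDeriv_dirDeriv_comp hU (hf.of_le (by norm_cast)) hp,
    fun K hK hKU ↦ ?_⟩
  -- `CurvatureBoundAt` carries the orthogonality at `p` as a hypothesis, so the covering argument
  -- runs over the compact set `K`; `K ∩ S` need not be compact.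
  obtain ⟨C, hC⟩ := PartialConformal.exists_forall_mem_of_isCompact hK
    (Q := PartialConformal.CurvatureBoundAt g r O) (fun _ _ _ h h' ↦ h'.mono h)
    (fun p hp ↦ PartialConformal.exists_local_curvature_bound g hU hr hO (hKU hp))
  refine ⟨C, fun f hf hfp p hp hδ V hV ↦ ?_⟩
  rw [hr.2 p (hKU hp.1), mul_one, mul_one]
  exact hC p hp.1 f hf hfp (hOX p hp.2) hδ V hV
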